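/- Let $\rho:\mathrm{SO}(3)\to\mathrm{SO}(9)$ be the irreducible representation on the fourth band of spherical harmonics: $\rho(r)$ is the matrix of the action $(r\cdot p)(x)=p(r^{-1}x)$ on the $9$-dimensional space of harmonic homogeneous polynomials of degree $4$ in three variables, with respect to the $L^2(S^2)$-orthonormal basis of real spherical harmonics $Y_{4,-4},\dots,Y_{4,4}$. Let $\mathrm{O}\subset\mathrm{SO}(3)$ be the octahedral group, generated by the right-angle rotations about the three coordinate axes, let $$q_0=\Bigl(0,0,0,0,\sqrt{\tfrac{7}{12}},0,0,0,\sqrt{\tfrac{5}{12}}\Bigr)^{\top}\in\mathbb{R}^9,\qquad F=\{\rho(r)q_0 : r\in\mathrm{SO}(3)\},$$ and let $\alpha=\sqrt{3/20}$, $q_\alpha=\alpha q_0$, $F_\alpha=\alpha F=\{\alpha q: q\in F\}$. Equip $\mathrm{SO}(3)$ with the bi-invariant Riemannian metric given at the identity by $\langle u,v\rangle=\tfrac12\sum_{i,j}u_{ij}v_{ij}$, and equip the quotient $\mathrm{SO}(3)/\mathrm{O}$ by right multiplication with the smooth structure and the Riemannian metric that descend from $\mathrm{SO}(3)$. Then $F_\alpha$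 is an embedded smooth submanifold of $\mathbb{R}^9$, of dimension $3$, and for the Riemannian metric on $F_\alpha$ induced by the Euclidean metric of $\mathbb{R}^9$ the following hold. 1. The map $\mathrm{SO}(3)\to F_\alpha$, $r\mapsto\rho(r)q_\alpha$, is a local isometry, that is, a smooth local diffeomorphism whose differential preserves the inner products of tangent vectors. 2. The induced map $\phi_\alpha:\mathrm{SO}(3)/\mathrm{O}\to F_\alpha$, $r\,\mathrm{O}\mapsto\rho(r)q_\alpha$, is a well-defined diffeomorphism, is equivariant, i.e. $\phi_\alpha(r\cdot x)=\rho(r)\phi_\alpha(x)$ for all $r\in\mathrm{SO}(3)$ and $x\in\mathrm{SO}(3)/\mathrm{O}$, and is an isometry of Riemannian manifolds. -/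

import Mathlib

open scoped Manifold ContDiff Matrix

noncomputable section

namespace OctahedralFrames

/-- The rotation group `SO(3)`, with the topology and group structure of real matrices. -/
abbrev SO3 : Type := Matrix.specialOrthogonalGroup (Fin 3) ℝ

/-- Euclidean three-space, the model space of all manifolds below. -/
abbrev E3 : Type := EuclideanSpace ℝ (Fin 3)

/-! ### The smooth structure of `SO(3)`: translates of the Cayley chart -/

/-- The Cayley parametrization `x ↦ (1 + S)(1 - S)⁻¹`, where `S v = x × v`, written out. -/
def cayleyMatrix (x : E3) : Matrix (Fin 3) (Fin 3) ℝ :=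
  (1 + x 0 ^ 2 + x 1 ^ 2 + x 2 ^ 2)⁻¹ •
    !![1 + x 0 ^ 2 - x 1 ^ 2 - x 2 ^ 2, 2 * (x 0 * x 1 - x 2), 2 * (x 0 * x 2 + x 1);
       2 * (x 0 * x 1 + x 2), 1 - x 0 ^ 2 + x 1 ^ 2 - x 2 ^ 2, 2 * (x 1 * x 2 - x 0);
       2 * (x 0 * x 2 - x 1), 2 * (x 1 * x 2 + x 0), 1 - x 0 ^ 2 - x 1 ^ 2 + x 2 ^ 2]

/-- The inverse of the Cayley parametrization, on matrices of trace different from `-1`. -/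
def cayleyCoord (A : Matrix (Fin 3) (Fin 3) ℝ) : E3 :=
  !₂[(A 2 1 - A 1 2) / (1 + A.trace), (A 0 2 - A 2 0) / (1 + A.trace),
    (A 1 0 - A 0 1) / (1 + A.trace)]

lemma cayley_pos (x : E3) : 0 < 1 + x 0 ^ 2 + x 1 ^ 2 + x 2 ^ 2 := by positivity

lemma cayleyMatrix_mem (x : E3) : cayleyMatrix x ∈ Matrix.specialOrthogonalGroup (Fin 3) ℝ := by
  have h := (cayley_pos x).ne'
  rw [Matrix.mem_specialOrthogonalGroup_iff, Matrix.mem_orthogonalGroup_iff]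
  constructor
  · ext i j
    fin_cases i <;> fin_cases j <;>
      simp [cayleyMatrix, Matrix.mul_apply, Fin.sum_univ_three] <;> field_simp <;> ring
  · simp [cayleyMatrix, Matrix.det_fin_three]
    field_simp
    ring

/-- The Cayley parametrization as a map into `SO(3)`. -/
def cayley (x : E3) : SO3 := ⟨cayleyMatrix x, cayleyMatrix_mem x⟩

lemma one_add_trace_cayleyMatrix (x : E3) :
    1 + (cayleyMatrix x).trace = 4 * (1 + x 0 ^ 2 + x 1 ^ 2 + x 2 ^ 2)⁻¹ := by
  have h := (cayley_pos x).ne'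
  simp [cayleyMatrix, Matrix.trace_fin_three]
  field_simp
  ring

lemma cayleyCoord_cayleyMatrix (x : E3) : cayleyCoord (cayleyMatrix x) = x := by
  have h := (cayley_pos x).ne'
  ext i
  fin_cases i <;> simp [cayleyCoord, one_add_trace_cayleyMatrix] <;>
    simp [cayleyMatrix] <;> field_simp <;> ring

lemma adjugate_SO3 (g : SO3) : (g : Matrix (Fin 3) (Fin 3) ℝ).adjugate = (g.1)ᵀ := by
  have h1 : g.1ᵀ * g.1 = 1 :=
    (Matrix.mem_orthogonalGroup_iff' (Fin 3) ℝ).1 (Matrix.mem_specialOrthogonalGroup_iff.1 g.2).1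
  have h2 : g.1.det = 1 := (Matrix.mem_specialOrthogonalGroup_iff.1 g.2).2
  calc g.1.adjugate = g.1ᵀ * g.1 * g.1.adjugate := by rw [h1, one_mul]
    _ = _ := by rw [mul_assoc, Matrix.mul_adjugate, h2, one_smul, mul_one]

lemma cayleyMatrix_cayleyCoord (g : SO3) (hg : 1 + g.1.trace ≠ 0) :
    cayleyMatrix (cayleyCoord g.1) = g.1 := by
  have hr : g.1 * g.1ᵀ = 1 :=
    (Matrix.mem_orthogonalGroup_iff (Fin 3) ℝ).1 (Matrix.mem_specialOrthogonalGroup_iff.1 g.2).1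
  have hc : g.1ᵀ * g.1 = 1 :=
    (Matrix.mem_orthogonalGroup_iff' (Fin 3) ℝ).1 (Matrix.mem_specialOrthogonalGroup_iff.1 g.2).1
  have ha := adjugate_SO3 g
  generalize g.1 = A at *
  rw [Matrix.adjugate_fin_three] at ha
  simp only [← Matrix.ext_iff, Fin.forall_fin_succ, Matrix.mul_apply, Fin.sum_univ_three,
    Matrix.transpose_apply, Matrix.one_apply] at hr hc ha
  simp at hr hc ha
  have ht : 1 + A.trace = 1 + A 0 0 + A 1 1 + A 2 2 := by rw [Matrix.trace_fin_three]; ring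
  set t := 1 + A.trace with htdef
  obtain ⟨⟨r00, r01, r02⟩, ⟨r10, r11, r12⟩, r20, r21, r22⟩ := hr
  obtain ⟨⟨c00, c01, c02⟩, ⟨c10, c11, c12⟩, c20, c21, c22⟩ := hc
  obtain ⟨⟨a00, a01, a02⟩, ⟨a10, a11, a12⟩, a20, a21, a22⟩ := ha
  have s0 : (A 2 1 - A 1 2) ^ 2 = t * (1 + A 0 0 - A 1 1 - A 2 2) := by
    rw [ht]; linear_combination r11 + r22 - c00 + 2 * a00
  have s1 : (A 0 2 - A 2 0) ^ 2 = t * (1 - A 0 0 + A 1 1 - A 2 2) := by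
    rw [ht]; linear_combination r00 + r22 - c11 + 2 * a11
  have s2 : (A 1 0 - A 0 1) ^ 2 = t * (1 - A 0 0 - A 1 1 + A 2 2) := by
    rw [ht]; linear_combination r00 + r11 - c22 + 2 * a22
  have p01 : (A 2 1 - A 1 2) * (A 0 2 - A 2 0) = t * (A 0 1 + A 1 0) := by
    rw [ht]; grind
  have p02 : (A 2 1 - A 1 2) * (A 1 0 - A 0 1) = t * (A 0 2 + A 2 0) := by
    rw [ht]; grind
  have p12 : (A 0 2 - A 2 0) * (A 1 0 - A 0 1) = t * (A 1 2 + A 2 1) := by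
    rw [ht]; grind
  have hN : (1 + cayleyCoord A 0 ^ 2 + cayleyCoord A 1 ^ 2 + cayleyCoord A 2 ^ 2) = 4 / t := by
    simp only [cayleyCoord, ← htdef]
    simp
    field_simp
    rw [s0, s1, s2, ht]; ring
  ext i j
  rw [cayleyMatrix, hN]
  fin_cases i <;> fin_cases j <;> simp [cayleyCoord, ← htdef] <;> field_simp
  · rw [s0, s1, s2, ht]; ring
  · linear_combination 2 * p01
  · linear_combination 2 * p02
  · linear_combination 2 * p01
  · rw [s0, s1, s2, ht]; ring
  · linear_combination 2 * p12
  · linear_combination 2 * p02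
  · linear_combination 2 * p12
  · rw [s0, s1, s2, ht]; ring

lemma continuous_cayley : Continuous cayley := by
  refine Continuous.subtype_mk ?_ _
  have hi : Continuous fun x : E3 => (1 + x 0 ^ 2 + x 1 ^ 2 + x 2 ^ 2)⁻¹ :=
    Continuous.inv₀ (by fun_prop) fun x => (cayley_pos x).ne'
  refine continuous_matrix fun i j => ?_
  fin_cases i <;> fin_cases j <;> simp [cayleyMatrix] <;> exact hi.mul (by fun_prop)

lemma continuousOn_cayleyCoord :
    ContinuousOn cayleyCoord {A : Matrix (Fin 3) (Fin 3) ℝ | 1 + A.trace ≠ 0} := by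
  unfold cayleyCoord
  refine (PiLp.continuous_toLp 2 _).comp_continuousOn (continuousOn_pi.2 fun i => ?_)
  have ht : Continuous fun A : Matrix (Fin 3) (Fin 3) ℝ => 1 + A.trace :=
    continuous_const.add continuous_id.matrix_trace
  have he (i j : Fin 3) : Continuous fun A : Matrix (Fin 3) (Fin 3) ℝ => A i j :=
    continuous_id.matrix_elem i j
  fin_cases i <;> simp <;>
    exact ContinuousOn.div ((he _ _).sub (he _ _)).continuousOn ht.continuousOn fun A hA => hA

lemma continuous_SO3_translate (g : SO3) : Continuous fun h : SO3 => g * h := by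
  refine Continuous.subtype_mk ?_ _
  exact continuous_const.matrix_mul continuous_subtype_val

/-- The Cayley chart translated to the rotation `g`: it sends `h` with `tr (g⁻¹ h) ≠ -1` to the
Cayley coordinates of `g⁻¹ h`. -/
def cayleyChart (g : SO3) : OpenPartialHomeomorph SO3 E3 where
  toFun h := cayleyCoord (g⁻¹ * h).1
  invFun x := g * cayley x
  source := {h | 1 + (g⁻¹ * h).1.trace ≠ 0}
  target := Set.univ
  map_source' _ _ := Set.mem_univ _
  map_target' x _ := by
    have h := (cayley_pos x).ne'
    simp only [inv_mul_cancel_left, Set.mem_ofPred_eq]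
    simp only [cayley, one_add_trace_cayleyMatrix]
    positivity
  left_inv' h hh := by
    have : cayley (cayleyCoord (g⁻¹ * h).1) = g⁻¹ * h :=
      Subtype.ext (cayleyMatrix_cayleyCoord _ hh)
    simp only [this, mul_inv_cancel_left]
  right_inv' x _ := by
    simp only [inv_mul_cancel_left]
    exact cayleyCoord_cayleyMatrix x
  continuousOn_toFun := continuousOn_cayleyCoord.comp
    (continuous_subtype_val.comp (continuous_SO3_translate g⁻¹)).continuousOn fun _ h => h
  continuousOn_invFun := ((continuous_SO3_translate g).comp continuous_cayley).continuousOn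
  open_source := by
    have : Continuous fun h : SO3 => 1 + (g⁻¹ * h).1.trace :=
      continuous_const.add
        (continuous_subtype_val.comp (continuous_SO3_translate g⁻¹)).matrix_trace
    exact isOpen_ne.preimage this
  open_target := isOpen_univ

instance : ChartedSpace E3 SO3 where
  atlas := Set.range cayleyChart
  chartAt := cayleyChart
  mem_chart_source g := by
    simp only [cayleyChart, inv_mul_cancel, Set.mem_ofPred_eq]
    simp
    norm_num
  chart_mem_atlas g := ⟨g, rfl⟩

lemma contDiff_cayleyMatrix (i j : Fin 3) : ContDiff ℝ ∞ fun x : E3 => cayleyMatrix x i j := by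
  have hi : ContDiff ℝ ∞ fun x : E3 => (1 + x 0 ^ 2 + x 1 ^ 2 + x 2 ^ 2)⁻¹ :=
    ContDiff.inv (by fun_prop) fun x => (cayley_pos x).ne'
  fin_cases i <;> fin_cases j <;> simp [cayleyMatrix] <;> exact hi.mul (by fun_prop)

/-- `cayleyCoord` is smooth along families of matrices with smooth entries. -/
lemma contDiffOn_cayleyCoord {E : Type*} [NormedAddCommGroup E] [NormedSpace ℝ E]
    {A : E → Matrix (Fin 3) (Fin 3) ℝ} {s : Set E}
    (hA : ∀ i j, ContDiffOn ℝ ∞ (fun x => A x i j) s) (hs : ∀ x ∈ s, 1 + (A x).trace ≠ 0) :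
    ContDiffOn ℝ ∞ (fun x => cayleyCoord (A x)) s := by
  have ht : ContDiffOn ℝ ∞ (fun x => 1 + (A x).trace) s := by
    simp only [Matrix.trace_fin_three]
    exact contDiffOn_const.add (((hA _ _).add (hA _ _)).add (hA _ _))
  refine contDiffOn_euclidean.2 fun i => ?_
  fin_cases i <;> simp [cayleyCoord] <;> exact ((hA _ _).sub (hA _ _)).div ht hs

lemma contDiff_mul_cayleyMatrix (B : Matrix (Fin 3) (Fin 3) ℝ) (i j : Fin 3) :
    ContDiff ℝ ∞ fun x : E3 => (B * cayleyMatrix x) i j := by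
  simp only [Matrix.mul_apply, Fin.sum_univ_three]
  have h := contDiff_cayleyMatrix
  exact ((contDiff_const.mul (h _ _)).add (contDiff_const.mul (h _ _))).add
    (contDiff_const.mul (h _ _))

instance : IsManifold (𝓡 3) ∞ SO3 := by
  refine isManifold_of_contDiffOn _ _ _ ?_
  rintro _ _ ⟨g, rfl⟩ ⟨h, rfl⟩
  have key : ContDiffOn ℝ ∞ (fun x : E3 => cayleyCoord ((h⁻¹ * g).1 * cayleyMatrix x))
      {x | 1 + ((h⁻¹ * g).1 * cayleyMatrix x).trace ≠ 0} :=
    contDiffOn_cayleyCoord (fun i j => (contDiff_mul_cayleyMatrix _ i j).contDiffOn) fun _ h => h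
  have e (x : E3) : (h⁻¹ * g).1 * cayleyMatrix x = (h⁻¹ * (g * cayley x)).1 := by
    rw [← mul_assoc]; rfl
  simp only [e] at key
  refine key.mono ?_
  rintro x ⟨hx, -⟩
  exact hx.2

/-- The inclusion of `SO(3)` into the Euclidean space of `3 × 3` matrices (Frobenius product). -/
def so3Incl (g : SO3) : EuclideanSpace ℝ (Fin 3 × Fin 3) := WithLp.toLp 2 fun p => g.1 p.1 p.2

lemma contMDiff_so3Incl :
    ContMDiff (𝓡 3) 𝓘(ℝ, EuclideanSpace ℝ (Fin 3 × Fin 3)) ∞ so3Incl := by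
  intro g
  rw [contMDiffAt_iff_source]
  refine ContMDiffAt.contMDiffWithinAt (ContDiffAt.contMDiffAt ?_)
  have : ContDiff ℝ ∞ fun x : E3 => so3Incl (g * cayley x) :=
    contDiff_euclidean.2 fun p => contDiff_mul_cayleyMatrix g.1 p.1 p.2
  exact this.contDiffAt

section
variable {E : Type*} [NormedAddCommGroup E] [NormedSpace ℝ E] {H : Type*} [TopologicalSpace H]
  {I : ModelWithCorners ℝ E H} {M : Type*} [TopologicalSpace M] [ChartedSpace H M]

/-- A map into `SO(3)` with smooth matrix entries is smooth. -/
lemma contMDiff_of_entries {f : M → SO3}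
    (hf : ∀ i j, ContMDiff I 𝓘(ℝ, ℝ) ∞ fun x => (f x).1 i j) : ContMDiff I (𝓡 3) ∞ f := by
  have hc : Continuous f :=
    Continuous.subtype_mk (continuous_matrix fun i j => (hf i j).continuous) _
  intro x
  rw [contMDiffAt_iff_target]
  refine ⟨hc.continuousAt, ?_⟩
  -- factor through the Euclidean space of matrices
  let A : EuclideanSpace ℝ (Fin 3 × Fin 3) → Matrix (Fin 3) (Fin 3) ℝ :=
    fun v => ((f x)⁻¹).1 * Matrix.of fun i j => v (i, j)
  have hA (i j : Fin 3) : ContDiff ℝ ∞ fun v => A v i j := by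
    simp only [A, Matrix.mul_apply, Fin.sum_univ_three, Matrix.of_apply]
    fun_prop
  let s : Set (EuclideanSpace ℝ (Fin 3 × Fin 3)) := {v | 1 + (A v).trace ≠ 0}
  have hs : IsOpen s := by
    refine isOpen_ne.preimage (continuous_const.add ?_)
    exact (continuous_matrix fun i j => (hA i j).continuous).matrix_trace
  have key : ContDiffOn ℝ ∞ (fun v => cayleyCoord (A v)) s :=
    contDiffOn_cayleyCoord (fun i j => (hA i j).contDiffOn) fun _ h => h
  have hxs : so3Incl (f x) ∈ s := mem_chart_source E3 (f x)
  have hincl : ContMDiff I 𝓘(ℝ, EuclideanSpace ℝ (Fin 3 × Fin 3)) ∞ fun y => so3Incl (f y) := by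
    have : ContMDiff I 𝓘(ℝ, Fin 3 × Fin 3 → ℝ) ∞ fun y (p : Fin 3 × Fin 3) => (f y).1 p.1 p.2 :=
      contMDiff_pi_space.2 fun p => hf p.1 p.2
    exact (EuclideanSpace.equiv (Fin 3 × Fin 3) ℝ).symm.contDiff.contMDiff.comp this
  have h1 : ContMDiffAt 𝓘(ℝ, EuclideanSpace ℝ (Fin 3 × Fin 3)) 𝓘(ℝ, E3) ∞
      (fun v => cayleyCoord (A v)) (so3Incl (f x)) :=
    (key.contDiffAt (hs.mem_nhds hxs)).contMDiffAt
  exact ContMDiffAt.comp (g := fun v => cayleyCoord (A v)) (f := fun y => so3Incl (f y)) x h1 (hincl x)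

end

lemma contMDiff_so3Entry (i j : Fin 3) :
    ContMDiff (𝓡 3) 𝓘(ℝ, ℝ) ∞ fun g : SO3 => g.1 i j := by
  have h : ContDiff ℝ ∞ fun v : EuclideanSpace ℝ (Fin 3 × Fin 3) => v (i, j) := by fun_prop
  exact h.contMDiff.comp contMDiff_so3Incl

lemma contMDiff_mul_left_SO3 (g : SO3) : ContMDiff (𝓡 3) (𝓡 3) ∞ fun h : SO3 => g * h := by
  refine contMDiff_of_entries fun i j => ?_
  have h := contMDiff_so3Entry
  have : (fun x : SO3 => (g * x).1 i j) =
      fun x => g.1 i 0 * x.1 0 j + g.1 i 1 * x.1 1 j + g.1 i 2 * x.1 2 j := by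
    ext x
    change (g.1 * x.1) i j = _
    simp only [Matrix.mul_apply, Fin.sum_univ_three]
  rw [this]
  exact ((contMDiff_const.mul (h _ _)).add (contMDiff_const.mul (h _ _))).add
    (contMDiff_const.mul (h _ _))

lemma contMDiff_mul_right_SO3 (g : SO3) : ContMDiff (𝓡 3) (𝓡 3) ∞ fun h : SO3 => h * g := by
  refine contMDiff_of_entries fun i j => ?_
  have h := contMDiff_so3Entry
  have : (fun x : SO3 => (x * g).1 i j) =
      fun x => x.1 i 0 * g.1 0 j + x.1 i 1 * g.1 1 j + x.1 i 2 * g.1 2 j := by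
    ext x
    change (x.1 * g.1) i j = _
    simp only [Matrix.mul_apply, Fin.sum_univ_three]
  rw [this]
  exact (((h _ _).mul contMDiff_const).add ((h _ _).mul contMDiff_const)).add
    ((h _ _).mul contMDiff_const)

instance : IsTopologicalGroup SO3 where
  continuous_mul := Continuous.subtype_mk
    ((continuous_subtype_val.comp continuous_fst).matrix_mul
      (continuous_subtype_val.comp continuous_snd)) _
  continuous_inv := Continuous.subtype_mk continuous_subtype_val.matrix_transpose _

/-! ### The octahedral group and the quotient manifold `SO(3)/O` -/

/-- The right-angle rotations `exp ((π / 2) lᵢ)` about the three coordinate axes. -/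
def quarterTurn : Fin 3 → SO3 :=
  ![⟨!![1, 0, 0; 0, 0, 1; 0, -1, 0], by
      rw [Matrix.mem_specialOrthogonalGroup_iff, Matrix.mem_orthogonalGroup_iff]
      refine ⟨?_, by simp [Matrix.det_fin_three]⟩
      ext i j
      fin_cases i <;> fin_cases j <;> simp [Matrix.mul_apply, Fin.sum_univ_three]⟩,
    ⟨!![0, 0, 1; 0, 1, 0; -1, 0, 0], by
      rw [Matrix.mem_specialOrthogonalGroup_iff, Matrix.mem_orthogonalGroup_iff]
      refine ⟨?_, by simp [Matrix.det_fin_three]⟩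
      ext i j
      fin_cases i <;> fin_cases j <;> simp [Matrix.mul_apply, Fin.sum_univ_three]⟩,
    ⟨!![0, 1, 0; -1, 0, 0; 0, 0, 1], by
      rw [Matrix.mem_specialOrthogonalGroup_iff, Matrix.mem_orthogonalGroup_iff]
      refine ⟨?_, by simp [Matrix.det_fin_three]⟩
      ext i j
      fin_cases i <;> fin_cases j <;> simp [Matrix.mul_apply, Fin.sum_univ_three]⟩]

/-- The octahedral group: the subgroup of `SO(3)` generated by the right-angle rotations about
the coordinate axes. -/
def octahedralGroup : Subgroup SO3 := Subgroup.closure (Set.range quarterTurn)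

lemma octahedralGroup_int {g : SO3} (hg : g ∈ octahedralGroup) (i j : Fin 3) :
    ∃ n : ℤ, g.1 i j = n := by
  induction hg using Subgroup.closure_induction generalizing i j with
  | mem x hx =>
    obtain ⟨k, rfl⟩ := hx
    have h0 : ∃ n : ℤ, (0 : ℝ) = n := ⟨0, by norm_num⟩
    have h1 : ∃ n : ℤ, (1 : ℝ) = n := ⟨1, by norm_num⟩
    have h2 : ∃ n : ℤ, (-1 : ℝ) = n := ⟨-1, by norm_num⟩
    fin_cases k <;> fin_cases i <;> fin_cases j <;> first | exact h0 | exact h1 | exact h2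
  | one => exact ⟨if i = j then 1 else 0, by simp [Matrix.one_apply]⟩
  | mul x y _ _ hx hy =>
    choose a ha using hx
    choose b hb using hy
    refine ⟨∑ k, a i k * b k j, ?_⟩
    change (x.1 * y.1) i j = _
    simp [Matrix.mul_apply, ha, hb]
  | inv x _ hx => exact hx j i

lemma isDiscrete_octahedralGroup : IsDiscrete (octahedralGroup : Set SO3) := by
  refine ⟨discreteTopology_of_isOpen_singleton_one (G := octahedralGroup) ?_⟩
  have hU : IsOpen {g : SO3 | ∀ i j, |g.1 i j - (1 : Matrix (Fin 3) (Fin 3) ℝ) i j| < 1} := by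
    simp only [Set.ofPred_forall]
    refine isOpen_iInter_of_finite fun i => isOpen_iInter_of_finite fun j => ?_
    refine isOpen_Iio.preimage (f := fun g : SO3 => |g.1 i j - (1 : Matrix _ _ ℝ) i j|) ?_
    exact ((continuous_subtype_val.matrix_elem i j).sub continuous_const).abs
  convert hU.preimage (continuous_subtype_val (p := fun g => g ∈ octahedralGroup))
  ext g
  simp only [Set.mem_singleton_iff, Set.mem_preimage, Set.mem_ofPred_eq]
  constructor
  · rintro rfl i j
    simp
  · intro h
    ext i j
    obtain ⟨n, hn⟩ := octahedralGroup_int g.2 i j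
    have hij := h i j
    obtain ⟨m, hm⟩ : ∃ m : ℤ, (1 : Matrix (Fin 3) (Fin 3) ℝ) i j = m :=
      ⟨if i = j then 1 else 0, by simp [Matrix.one_apply]⟩
    have hone : ((1 : octahedralGroup).1.1 : Matrix (Fin 3) (Fin 3) ℝ) i j = m := hm
    rw [hm, hn] at hij
    rw [hone, hn]
    have : |n - m| < 1 := by exact_mod_cast hij
    rw [Int.abs_lt_one_iff] at this
    rw [sub_eq_zero.1 this]

/-- The quotient `SO(3)/O` by the action of `O` by right multiplication. -/
abbrev FrameSpace : Type := SO3 ⧸ octahedralGroup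

/-- The quotient map `SO(3) → SO(3)/O`. -/
def frameMk (g : SO3) : FrameSpace := QuotientGroup.mk g

lemma frameMk_eq_iff {g h : SO3} : frameMk g = frameMk h ↔ ∃ o ∈ octahedralGroup, h = g * o := by
  rw [frameMk, frameMk, QuotientGroup.eq]
  exact ⟨fun H => ⟨_, H, by group⟩, by rintro ⟨o, ho, rfl⟩; simpa using ho⟩

lemma surjective_frameMk : Function.Surjective frameMk := QuotientGroup.mk_surjective

lemma isLocalHomeomorph_frameMk : IsLocalHomeomorph frameMk :=
  (octahedralGroup.isQuotientCoveringMap isDiscrete_octahedralGroup).isCoveringMap.isLocalHomeomorph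

/-- Charts of `SO(3)/O` are local inverses of the quotient map followed by charts of `SO(3)`. -/
instance : ChartedSpace E3 FrameSpace :=
  isLocalHomeomorph_frameMk.chartedSpace surjective_frameMk

/-- A local inverse of the quotient map composed with the quotient map is, locally, right
multiplication by a fixed element of `O`. -/
lemma localInverse_frameMk {X : Type*} [TopologicalSpace X] {f : X → SO3} {x : X}
    (hf : ContinuousAt f x) {g : SO3}
    (hx : frameMk (f x) ∈ (isLocalHomeomorph_frameMk.localInverseAt (x := g)).source) :
    ∃ o ∈ octahedralGroup, ∀ᶠ y in nhds x,
      isLocalHomeomorph_frameMk.localInverseAt (x := g) (frameMk (f y)) = f y * o := by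
  set e := isLocalHomeomorph_frameMk.localInverseAt (x := g) with he
  have h1 : frameMk (e (frameMk (f x))) = frameMk (f x) :=
    isLocalHomeomorph_frameMk.apply_localInverseAt_of_mem hx
  obtain ⟨o, ho, hox⟩ := frameMk_eq_iff.1 h1.symm
  refine ⟨o, ho, ?_⟩
  have hfo : ContinuousAt (fun y => f y * o) x := hf.mul continuousAt_const
  have ht : f x * o ∈ e.target := by rw [← hox]; exact e.map_source hx
  filter_upwards [hfo.preimage_mem_nhds (e.open_target.mem_nhds ht),
    (isLocalHomeomorph_frameMk.continuous.continuousAt.comp hf).preimage_mem_nhds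
      (e.open_source.mem_nhds hx)] with y hy1 hy2
  refine isLocalHomeomorph_frameMk.injOn_localInverseAt_target (x := g) (e.map_source hy2) hy1 ?_
  rw [isLocalHomeomorph_frameMk.apply_localInverseAt_of_mem hy2]
  exact frameMk_eq_iff.2 ⟨o, ho, rfl⟩

instance : IsManifold (𝓡 3) ∞ FrameSpace := by
  refine isManifold_of_contDiffOn _ _ _ ?_
  rintro _ _ ⟨p, rfl⟩ ⟨q, rfl⟩
  set g := surjective_frameMk.hasRightInverse.choose p
  set h := surjective_frameMk.hasRightInverse.choose q
  rintro x ⟨hx, -⟩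
  refine ContDiffAt.contDiffWithinAt ?_
  have hx1 : x ∈ (chartAt E3 g).target := hx.1.1
  have hx2 : frameMk ((chartAt E3 g).symm x) ∈
      (isLocalHomeomorph_frameMk.localInverseAt (x := h)).source := by
    have := hx.2.1
    simpa using this
  have hx3 : isLocalHomeomorph_frameMk.localInverseAt (x := h)
      (frameMk ((chartAt E3 g).symm x)) ∈ (chartAt E3 h).source := by
    have := hx.2.2
    simpa using this
  have hsm : ContMDiffAt (𝓡 3) (𝓡 3) ∞ (chartAt E3 g).symm x :=
    contMDiffOn_chart_symm.contMDiffAt ((chartAt E3 g).open_target.mem_nhds hx1)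
  obtain ⟨o, ho, hev⟩ := localInverse_frameMk hsm.continuousAt hx2
  rw [hev.self_of_nhds] at hx3
  have hc : ContMDiffAt (𝓡 3) (𝓡 3) ∞ (chartAt E3 h) ((chartAt E3 g).symm x * o) :=
    contMDiffOn_chart.contMDiffAt ((chartAt E3 h).open_source.mem_nhds hx3)
  have hcomp : ContMDiffAt (𝓡 3) (𝓡 3) ∞
      (fun y => chartAt E3 h ((chartAt E3 g).symm y * o)) x :=
    hc.comp x ((contMDiff_mul_right_SO3 o _).comp x hsm)
  refine ContDiffAt.congr_of_eventuallyEq (contMDiffAt_iff_contDiffAt.1 hcomp) ?_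
  filter_upwards [hev] with y hy
  simp only [Function.comp, ← hy]
  simp

lemma contMDiff_frameMk : ContMDiff (𝓡 3) (𝓡 3) ∞ frameMk := by
  intro r
  rw [contMDiffAt_iff_target]
  refine ⟨isLocalHomeomorph_frameMk.continuous.continuousAt, ?_⟩
  set g := surjective_frameMk.hasRightInverse.choose (frameMk r) with hg
  have hgr : frameMk g = frameMk r := surjective_frameMk.hasRightInverse.choose_spec (frameMk r)
  have hr : frameMk r ∈ (isLocalHomeomorph_frameMk.localInverseAt (x := g)).source := by
    rw [← hgr]; simp
  obtain ⟨o, ho, hev⟩ := localInverse_frameMk (f := id) continuousAt_id hr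
  have hro : r * o = g := by
    have := hev.self_of_nhds
    rw [id] at this
    rw [← this, ← hgr, isLocalHomeomorph_frameMk.localInverseAt_apply_self]
  have hc : ContMDiffAt (𝓡 3) (𝓡 3) ∞ (chartAt E3 g) (r * o) :=
    contMDiffOn_chart.contMDiffAt
      ((chartAt E3 g).open_source.mem_nhds (hro ▸ mem_chart_source E3 g))
  have hcomp : ContMDiffAt (𝓡 3) 𝓘(ℝ, E3) ∞ (fun y => chartAt E3 g (y * o)) r :=
    hc.comp r (contMDiff_mul_right_SO3 o r)
  refine hcomp.congr_of_eventuallyEq ?_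
  filter_upwards [hev] with y hy
  rw [id] at hy
  rw [← hy]
  rfl

lemma contMDiffOn_localInverse_frameMk (r : SO3) :
    ContMDiffOn (𝓡 3) (𝓡 3) ∞ (isLocalHomeomorph_frameMk.localInverseAt (x := r))
      (isLocalHomeomorph_frameMk.localInverseAt (x := r)).source := by
  intro q hq
  refine ContMDiffAt.contMDiffWithinAt ?_
  set g := surjective_frameMk.hasRightInverse.choose q with hg
  have hgq : frameMk g = q := surjective_frameMk.hasRightInverse.choose_spec q
  set e := isLocalHomeomorph_frameMk.localInverseAt (x := g) with he
  have hqe : q ∈ e.source := by rw [← hgq]; simp [he]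
  have heq : e q = g := by rw [← hgq]; simp [he]
  have hmk : ∀ y ∈ e.source, frameMk (e y) = y := fun y hy =>
    isLocalHomeomorph_frameMk.apply_localInverseAt_of_mem hy
  -- near `q`, `e` is a chart followed by the inverse of a chart of `SO(3)`
  have hes : ContMDiffAt (𝓡 3) (𝓡 3) ∞ e q := by
    have h1 : ContMDiffAt (𝓡 3) (𝓡 3) ∞ (chartAt E3 q) q :=
      contMDiffOn_chart.contMDiffAt ((chartAt E3 q).open_source.mem_nhds (mem_chart_source E3 q))
    have h2 : chartAt E3 q = e.trans (chartAt E3 g) := rfl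
    have h3 : chartAt E3 q q ∈ (chartAt E3 g).target := by
      rw [h2]
      simp only [OpenPartialHomeomorph.coe_trans, Function.comp, heq]
      exact mem_chart_target E3 g
    have h4 : ContMDiffAt (𝓡 3) (𝓡 3) ∞ (chartAt E3 g).symm (chartAt E3 q q) :=
      contMDiffOn_chart_symm.contMDiffAt ((chartAt E3 g).open_target.mem_nhds h3)
    refine (h4.comp q h1).congr_of_eventuallyEq ?_
    filter_upwards [(chartAt E3 q).open_source.mem_nhds (mem_chart_source E3 q)] with y hy
    rw [h2] at hy
    simp only [Function.comp, h2, OpenPartialHomeomorph.coe_trans]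
    exact ((chartAt E3 g).left_inv hy.2).symm
  have hq' : frameMk (e q) ∈ (isLocalHomeomorph_frameMk.localInverseAt (x := r)).source := by
    rwa [hmk q hqe]
  obtain ⟨o, ho, hev⟩ := localInverse_frameMk hes.continuousAt hq'
  refine ((contMDiff_mul_right_SO3 o _).comp q hes).congr_of_eventuallyEq ?_
  filter_upwards [hev, e.open_source.mem_nhds hqe] with y hy hye
  rw [hmk y hye] at hy
  rw [hy]
  rfl

/-- The quotient map is a local diffeomorphism. -/
lemma isLocalDiffeomorph_frameMk : IsLocalDiffeomorph (𝓡 3) (𝓡 3) ∞ frameMk := by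
  intro r
  let e := isLocalHomeomorph_frameMk.localInverseAt (x := r)
  refine ⟨{ e.symm.toPartialEquiv with
    open_source := e.open_target
    open_target := e.open_source
    contMDiffOn_toFun := ?_
    contMDiffOn_invFun := contMDiffOn_localInverse_frameMk r }, ?_, ?_⟩
  · have : (e.symm : SO3 → FrameSpace) = frameMk := isLocalHomeomorph_frameMk.localInverseAt_symm r
    exact contMDiff_frameMk.contMDiffOn.congr fun y _ => congrFun this y
  · exact isLocalHomeomorph_frameMk.self_mem_localInverseAt_target
  · intro y _
    have : (e.symm : SO3 → FrameSpace) = frameMk := isLocalHomeomorph_frameMk.localInverseAt_symm r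
    exact (congrFun this y).symm

/-! ### Riemannian metrics -/

/-- A field of bilinear forms on the tangent spaces of a three-manifold. -/
abbrev MetricTensor (M : Type*) [TopologicalSpace M] [ChartedSpace E3 M] : Type _ :=
  ∀ x : M, LinearMap.BilinForm ℝ (TangentSpace (𝓡 3) x)

section
variable {M : Type*} [TopologicalSpace M] [ChartedSpace E3 M]
  {N : Type*} [TopologicalSpace N] [ChartedSpace E3 N]

/-- The metric induced on `M` by a map `f` into a Euclidean space:
`⟨v, w⟩ₓ = ⟨df v, df w⟩`. -/
def inducedMetric {V : Type*} [NormedAddCommGroup V] [InnerProductSpace ℝ V] (f : M → V) :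
    MetricTensor M := fun x =>
  (innerₗ V).compl₁₂ (mfderiv (𝓡 3) 𝓘(ℝ, V) f x : TangentSpace (𝓡 3) x →L[ℝ] V).toLinearMap
    (mfderiv (𝓡 3) 𝓘(ℝ, V) f x : TangentSpace (𝓡 3) x →L[ℝ] V).toLinearMap

/-- The differential of `f : (M, gM) → (N, gN)` preserves inner products of tangent vectors. -/
def PreservesMetric (gM : MetricTensor M) (gN : MetricTensor N) (f : M → N) : Prop :=
  ∀ (x : M) (v w : TangentSpace (𝓡 3) x),
    gN (f x) (mfderiv (𝓡 3) (𝓡 3) f x v) (mfderiv (𝓡 3) (𝓡 3) f x w) = gM x v w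

/-- A local isometry of Riemannian manifolds: a smooth local diffeomorphism whose differential
preserves inner products. -/
def IsLocalIsometry (gM : MetricTensor M) (gN : MetricTensor N) (f : M → N) : Prop :=
  IsLocalDiffeomorph (𝓡 3) (𝓡 3) ∞ f ∧ PreservesMetric gM gN f

end

/-- The bi-invariant metric of `SO(3)`, equal to `½ ∑ uᵢⱼ vᵢⱼ` on tangent vectors `u`, `v`
regarded as matrices. -/
def so3Metric : MetricTensor SO3 := fun g => (1 / 2 : ℝ) • inducedMetric so3Incl g

lemma so3Metric_apply (g : SO3) (v w : TangentSpace (𝓡 3) g) :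
    so3Metric g v w = 1 / 2 * inner (E := EuclideanSpace ℝ (Fin 3 × Fin 3)) ℝ
      (mfderiv (𝓡 3) 𝓘(ℝ, EuclideanSpace ℝ (Fin 3 × Fin 3)) so3Incl g v)
      (mfderiv (𝓡 3) 𝓘(ℝ, EuclideanSpace ℝ (Fin 3 × Fin 3)) so3Incl g w) := rfl

/-- A smooth self-map of `SO(3)` that is the restriction of a linear isometry of the space of
matrices preserves the metric. -/
lemma so3Metric_of_linearIsometry {f : SO3 → SO3} (hf : ContMDiff (𝓡 3) (𝓡 3) ∞ f)
    (L : EuclideanSpace ℝ (Fin 3 × Fin 3) →L[ℝ] EuclideanSpace ℝ (Fin 3 × Fin 3))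
    (hL : ∀ v w, inner ℝ (L v) (L w) = inner ℝ v w) (h : ∀ g, so3Incl (f g) = L (so3Incl g)) :
    PreservesMetric so3Metric so3Metric f := by
  intro g v w
  have hcomp : so3Incl ∘ f = L ∘ so3Incl := funext h
  have hi (g) : MDifferentiableAt (𝓡 3) 𝓘(ℝ, EuclideanSpace ℝ (Fin 3 × Fin 3)) so3Incl g :=
    (contMDiff_so3Incl g).mdifferentiableAt (by simp)
  have h1 := mfderiv_comp g (hi (f g)) ((hf g).mdifferentiableAt (by simp))
  have h2 := mfderiv_comp g (L.contMDiff (n := 1) (so3Incl g) |>.mdifferentiableAt (by simp)) (hi g)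
  rw [hcomp, h2, ContinuousLinearMap.mfderiv_eq] at h1
  have h3 (u : TangentSpace (𝓡 3) g) := (DFunLike.congr_fun h1 u).symm
  rw [so3Metric_apply, so3Metric_apply]
  congr 1
  refine Eq.trans ?_ (hL _ _)
  exact congrArg₂ (inner ℝ) (h3 v) (h3 w)

/-- Left multiplication by a fixed matrix on the Euclidean space of matrices. -/
def matMulLeft (B : Matrix (Fin 3) (Fin 3) ℝ) :
    EuclideanSpace ℝ (Fin 3 × Fin 3) →L[ℝ] EuclideanSpace ℝ (Fin 3 × Fin 3) :=
  LinearMap.toContinuousLinearMap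
    { toFun v := WithLp.toLp 2 fun p => ∑ k, B p.1 k * v (k, p.2)
      map_add' v w := by ext p; simp [mul_add, Finset.sum_add_distrib]
      map_smul' c v := by ext p; simp [Finset.mul_sum, mul_left_comm] }

/-- Right multiplication by a fixed matrix on the Euclidean space of matrices. -/
def matMulRight (B : Matrix (Fin 3) (Fin 3) ℝ) :
    EuclideanSpace ℝ (Fin 3 × Fin 3) →L[ℝ] EuclideanSpace ℝ (Fin 3 × Fin 3) :=
  LinearMap.toContinuousLinearMap
    { toFun v := WithLp.toLp 2 fun p => ∑ k, v (p.1, k) * B k p.2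
      map_add' v w := by ext p; simp [add_mul, Finset.sum_add_distrib]
      map_smul' c v := by ext p; simp [Finset.mul_sum, mul_assoc] }

/-- Left translations are isometries of `SO(3)`. -/
lemma so3Metric_mul_left (g : SO3) : PreservesMetric so3Metric so3Metric fun h => g * h := by
  refine so3Metric_of_linearIsometry (contMDiff_mul_left_SO3 g) (matMulLeft g.1) ?_ fun h => rfl
  have hc : g.1ᵀ * g.1 = 1 :=
    (Matrix.mem_orthogonalGroup_iff' (Fin 3) ℝ).1 (Matrix.mem_specialOrthogonalGroup_iff.1 g.2).1
  intro v w
  simp [← Matrix.ext_iff, Fin.forall_fin_succ, Matrix.mul_apply, Fin.sum_univ_three,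
    Matrix.one_apply] at hc
  simp [matMulLeft, PiLp.inner_apply, Fintype.sum_prod_type, Fin.sum_univ_three]
  obtain ⟨⟨c00, c01, c02⟩, ⟨c10, c11, c12⟩, c20, c21, c22⟩ := hc
  have key (a b c a' b' c' : ℝ) :
      (g.1 0 0 * a + g.1 0 1 * b + g.1 0 2 * c) * (g.1 0 0 * a' + g.1 0 1 * b' + g.1 0 2 * c') +
      (g.1 1 0 * a + g.1 1 1 * b + g.1 1 2 * c) * (g.1 1 0 * a' + g.1 1 1 * b' + g.1 1 2 * c') +
      (g.1 2 0 * a + g.1 2 1 * b + g.1 2 2 * c) * (g.1 2 0 * a' + g.1 2 1 * b' + g.1 2 2 * c') =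
      a * a' + b * b' + c * c' := by
    linear_combination a * a' * c00 + b * b' * c11 + c * c' * c22 + (a * b' + b * a') * c01 +
      (a * c' + c * a') * c02 + (b * c' + c * b') * c12
  linear_combination key (w (0, 0)) (w (1, 0)) (w (2, 0)) (v (0, 0)) (v (1, 0)) (v (2, 0)) +
    key (w (0, 1)) (w (1, 1)) (w (2, 1)) (v (0, 1)) (v (1, 1)) (v (2, 1)) +
    key (w (0, 2)) (w (1, 2)) (w (2, 2)) (v (0, 2)) (v (1, 2)) (v (2, 2))

/-- Right translations are isometries of `SO(3)`. -/
lemma so3Metric_mul_right (g : SO3) : PreservesMetric so3Metric so3Metric fun h => h * g := by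
  refine so3Metric_of_linearIsometry (contMDiff_mul_right_SO3 g) (matMulRight g.1) ?_ fun h => rfl
  have hc : g.1 * g.1ᵀ = 1 :=
    (Matrix.mem_orthogonalGroup_iff (Fin 3) ℝ).1 (Matrix.mem_specialOrthogonalGroup_iff.1 g.2).1
  intro v w
  simp [← Matrix.ext_iff, Fin.forall_fin_succ, Matrix.mul_apply, Fin.sum_univ_three,
    Matrix.one_apply] at hc
  simp [matMulRight, PiLp.inner_apply, Fintype.sum_prod_type, Fin.sum_univ_three]
  obtain ⟨⟨c00, c01, c02⟩, ⟨c10, c11, c12⟩, c20, c21, c22⟩ := hc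
  have key (a b c a' b' c' : ℝ) :
      (g.1 0 0 * a + g.1 1 0 * b + g.1 2 0 * c) * (g.1 0 0 * a' + g.1 1 0 * b' + g.1 2 0 * c') +
      (g.1 0 1 * a + g.1 1 1 * b + g.1 2 1 * c) * (g.1 0 1 * a' + g.1 1 1 * b' + g.1 2 1 * c') +
      (g.1 0 2 * a + g.1 1 2 * b + g.1 2 2 * c) * (g.1 0 2 * a' + g.1 1 2 * b' + g.1 2 2 * c') =
      a * a' + b * b' + c * c' := by
    linear_combination a * a' * c00 + b * b' * c11 + c * c' * c22 + (a * b' + b * a') * c01 +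
      (a * c' + c * a') * c02 + (b * c' + c * b') * c12
  linear_combination key (w (0, 0)) (w (0, 1)) (w (0, 2)) (v (0, 0)) (v (0, 1)) (v (0, 2)) +
    key (w (1, 0)) (w (1, 1)) (w (1, 2)) (v (1, 0)) (v (1, 1)) (v (1, 2)) +
    key (w (2, 0)) (w (2, 1)) (w (2, 2)) (v (2, 0)) (v (2, 1)) (v (2, 2))

/-- The metric of `SO(3)/O` to which the metric of `SO(3)` descends: tangent vectors at a coset are
lifted to a representative through the inverse of the differential of the quotient map. -/
def frameMetric : MetricTensor FrameSpace := fun x =>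
  (so3Metric (Quotient.out x)).compl₁₂
    (ContinuousLinearMap.inverse (mfderiv (𝓡 3) (𝓡 3) frameMk (Quotient.out x)) :
      TangentSpace (𝓡 3) x →L[ℝ] TangentSpace (𝓡 3) (Quotient.out x)).toLinearMap
    (ContinuousLinearMap.inverse (mfderiv (𝓡 3) (𝓡 3) frameMk (Quotient.out x)) :
      TangentSpace (𝓡 3) x →L[ℝ] TangentSpace (𝓡 3) (Quotient.out x)).toLinearMap

lemma mfderiv_frameMk_mul (r : SO3) {o : SO3} (ho : o ∈ octahedralGroup)
    (v : TangentSpace (𝓡 3) r) :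
    (mfderiv (𝓡 3) (𝓡 3) frameMk (r * o) (mfderiv (𝓡 3) (𝓡 3) (fun h => h * o) r v) : E3) =
      mfderiv (𝓡 3) (𝓡 3) frameMk r v := by
  have h1 : frameMk ∘ (fun h => h * o) = frameMk :=
    funext fun h => (frameMk_eq_iff.2 ⟨o, ho, rfl⟩ : frameMk h = frameMk (h * o)).symm
  have h2 := mfderiv_comp r ((contMDiff_frameMk (r * o)).mdifferentiableAt (by simp))
    ((contMDiff_mul_right_SO3 o r).mdifferentiableAt (by simp))
  have h3 : mfderiv (𝓡 3) (𝓡 3) (frameMk ∘ (fun h => h * o)) r v =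
    mfderiv (𝓡 3) (𝓡 3) frameMk (r * o) (mfderiv (𝓡 3) (𝓡 3) (fun h => h * o) r v) :=
    DFunLike.congr_fun h2 v
  refine h3.symm.trans ?_
  have h4 (f : SO3 → FrameSpace) (hf : f = frameMk) :
      (mfderiv (𝓡 3) (𝓡 3) f r v : E3) = mfderiv (𝓡 3) (𝓡 3) frameMk r v := by
    subst hf; rfl
  exact h4 _ h1

/-- The metric of `SO(3)` descends to `SO(3)/O`: the quotient map is a local isometry. -/
lemma isLocalIsometry_frameMk : IsLocalIsometry so3Metric frameMetric frameMk := by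
  refine ⟨isLocalDiffeomorph_frameMk, fun r v w => ?_⟩
  set s : SO3 := Quotient.out (frameMk r) with hs
  have hsr : frameMk s = frameMk r := Quotient.out_eq (frameMk r)
  obtain ⟨o, ho, hso⟩ := frameMk_eq_iff.1 hsr.symm
  let e := (isLocalDiffeomorph_frameMk s).mfderivToContinuousLinearEquiv (by simp)
  have he : mfderiv (𝓡 3) (𝓡 3) frameMk s = e := rfl
  -- lifts to the chosen representative are right translates
  have key (u : TangentSpace (𝓡 3) r) :
      (ContinuousLinearMap.inverse (mfderiv (𝓡 3) (𝓡 3) frameMk s)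
        (mfderiv (𝓡 3) (𝓡 3) frameMk r u : E3) : E3) =
      (mfderiv (𝓡 3) (𝓡 3) (fun h => h * o) r u : E3) := by
    rw [he, ContinuousLinearMap.inverse_equiv]
    refine (e.symm_apply_eq).2 ?_
    have h1 := mfderiv_frameMk_mul r ho u
    have h2 (t : SO3) (ht : t = s) (z : E3) :
        (mfderiv (𝓡 3) (𝓡 3) frameMk t z : E3) = mfderiv (𝓡 3) (𝓡 3) frameMk s z := by
      subst ht; rfl
    exact h1.symm.trans (h2 _ hso.symm _)
  have h3 := so3Metric_mul_right o r v w
  have h4 (t : SO3) (ht : t = s) (z z' : E3) : so3Metric t z z' = so3Metric s z z' := by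
    subst ht; rfl
  refine Eq.trans ?_ ((h4 _ hso.symm _ _).symm.trans h3)
  exact congrArg₂ (fun a b : E3 => so3Metric s a b) (key v) (key w)

/-! ### The band-four representation -/

open MvPolynomial in
/-- The Laplacian on real polynomials in three variables. -/
def laplacian : MvPolynomial (Fin 3) ℝ →ₗ[ℝ] MvPolynomial (Fin 3) ℝ :=
  ∑ i, (pderiv i).toLinearMap ∘ₗ (pderiv i).toLinearMap

lemma laplacian_apply (p : MvPolynomial (Fin 3) ℝ) :
    laplacian p = ∑ i, MvPolynomial.pderiv i (MvPolynomial.pderiv i p) := by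
  simp [laplacian]

/-- The fourth band of spherical harmonics, as the space of harmonic homogeneous polynomials of
degree four. -/
def bandFour : Submodule ℝ (MvPolynomial (Fin 3) ℝ) :=
  MvPolynomial.homogeneousSubmodule (Fin 3) ℝ 4 ⊓ LinearMap.ker laplacian

open MvPolynomial in
/-- Rotation of a polynomial: `(r p)(x) = p(r⁻¹ x)`. -/
def rotatePoly (r : SO3) : MvPolynomial (Fin 3) ℝ →ₐ[ℝ] MvPolynomial (Fin 3) ℝ :=
  aeval fun i => ∑ j, C (r.1 j i) * X j

open MvPolynomial in
lemma rotatePoly_X (r : SO3) (i : Fin 3) : rotatePoly r (X i) = ∑ j, C (r.1 j i) * X j := by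
  simp [rotatePoly]

lemma rotatePoly_one (p : MvPolynomial (Fin 3) ℝ) : rotatePoly 1 p = p := by
  have : rotatePoly 1 = AlgHom.id ℝ (MvPolynomial (Fin 3) ℝ) := by
    refine MvPolynomial.algHom_ext fun i => ?_
    simp only [rotatePoly_X, AlgHom.id_apply]
    have h (j : Fin 3) : ((1 : SO3).1 j i : ℝ) = if j = i then 1 else 0 := Matrix.one_apply
    simp [h, apply_ite MvPolynomial.C, ite_mul]
  rw [this]; rfl

open MvPolynomial in
lemma rotatePoly_mul (r s : SO3) (p : MvPolynomial (Fin 3) ℝ) :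
    rotatePoly (r * s) p = rotatePoly r (rotatePoly s p) := by
  have : rotatePoly (r * s) = (rotatePoly r).comp (rotatePoly s) := by
    refine MvPolynomial.algHom_ext fun i => ?_
    have hC (c : ℝ) : rotatePoly r (C c) = C c := by simp [rotatePoly]
    have h (j : Fin 3) : (r * s).1 j i = ∑ k, r.1 j k * s.1 k i := Matrix.mul_apply
    rw [AlgHom.comp_apply, rotatePoly_X, rotatePoly_X]
    simp only [map_sum, map_mul, hC, rotatePoly_X, h]
    simp only [Fin.sum_univ_three, map_add, map_mul]
    ring
  rw [this]; rfl

open MvPolynomial in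
lemma pderiv_rotatePoly (r : SO3) (j : Fin 3) (p : MvPolynomial (Fin 3) ℝ) :
    pderiv j (rotatePoly r p) = ∑ i, C (r.1 j i) * rotatePoly r (pderiv i p) := by
  induction p using MvPolynomial.induction_on with
  | C a => simp [rotatePoly]
  | add p q hp hq => simp only [map_add, hp, hq, mul_add, Finset.sum_add_distrib]
  | mul_X p n hp =>
    rw [map_mul, Derivation.leibniz, hp]
    have h1 : pderiv j (rotatePoly r (X n)) = C (r.1 j n) := by
      rw [rotatePoly_X, map_sum]
      simp only [Derivation.leibniz, pderiv_X, pderiv_C, smul_eq_mul, mul_zero, add_zero]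
      simp [Pi.single_apply]
    rw [h1]
    have h2 (i : Fin 3) : rotatePoly r (pderiv i (p * X n)) =
        rotatePoly r p * (if i = n then 1 else 0) +
          rotatePoly r (X n) * rotatePoly r (pderiv i p) := by
      rw [Derivation.leibniz, pderiv_X]
      by_cases h : i = n
      · subst h; simp
      · simp [h, Ne.symm h]
    simp only [h2, smul_eq_mul, Finset.mul_sum, mul_add, Finset.sum_add_distrib]
    congr 1
    · simp [mul_comm]
    · exact Finset.sum_congr rfl fun i _ => by ring

lemma laplacian_rotatePoly (r : SO3) (p : MvPolynomial (Fin 3) ℝ) :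
    laplacian (rotatePoly r p) = rotatePoly r (laplacian p) := by
  have hc : r.1ᵀ * r.1 = 1 :=
    (Matrix.mem_orthogonalGroup_iff' (Fin 3) ℝ).1 (Matrix.mem_specialOrthogonalGroup_iff.1 r.2).1
  have hc' (i k : Fin 3) : ∑ j, MvPolynomial.C (r.1 j i) * MvPolynomial.C (r.1 j k) =
      if i = k then (1 : MvPolynomial (Fin 3) ℝ) else 0 := by
    have := congrFun (congrFun hc i) k
    rw [Matrix.mul_apply] at this
    simp only [← map_mul, ← map_sum]
    simp only [Matrix.transpose_apply] at this
    rw [this, Matrix.one_apply]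
    split_ifs <;> simp
  simp only [laplacian_apply, pderiv_rotatePoly, map_sum, Derivation.leibniz, MvPolynomial.pderiv_C,
    smul_eq_mul, mul_zero, add_zero, Finset.mul_sum]
  rw [Finset.sum_comm]
  refine Finset.sum_congr rfl fun i _ => ?_
  rw [Finset.sum_comm]
  calc _ = ∑ k, (∑ j, MvPolynomial.C (r.1 j i) * MvPolynomial.C (r.1 j k)) *
        rotatePoly r (MvPolynomial.pderiv k (MvPolynomial.pderiv i p)) := by
        refine Finset.sum_congr rfl fun k _ => ?_
        rw [Finset.sum_mul]
        exact Finset.sum_congr rfl fun j _ => by ring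
    _ = _ := by simp [hc']

lemma rotatePoly_mem (r : SO3) {p : MvPolynomial (Fin 3) ℝ} (hp : p ∈ bandFour) :
    rotatePoly r p ∈ bandFour := by
  obtain ⟨h1, h2⟩ := hp
  refine ⟨?_, ?_⟩
  · have h := (MvPolynomial.mem_homogeneousSubmodule 4 p).1 h1
    refine (MvPolynomial.mem_homogeneousSubmodule 4 _).2 ?_
    have := h.aeval (fun i => ∑ j, MvPolynomial.C (r.1 j i) * MvPolynomial.X j) (n := 1)
      fun i => MvPolynomial.IsHomogeneous.sum _ _ _ fun j _ => ?_
    · simpa [rotatePoly] using this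
    · simpa using (MvPolynomial.isHomogeneous_C (Fin 3) (r.1 j i)).mul
        (MvPolynomial.isHomogeneous_X ℝ j)
  · rw [SetLike.mem_coe, LinearMap.mem_ker] at h2 ⊢
    rw [laplacian_rotatePoly, h2, map_zero]

/-- The action of `SO(3)` on the fourth band of spherical harmonics. -/
def bandFourRep : Representation ℝ SO3 bandFour where
  toFun r := (rotatePoly r).toLinearMap.restrict fun _ hp => rotatePoly_mem r hp
  map_one' := by
    ext1 p
    exact Subtype.ext (rotatePoly_one p.1)
  map_mul' r s := by
    ext1 p
    exact Subtype.ext (rotatePoly_mul r s p.1)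

open MvPolynomial in
/-- Unnormalized real spherical harmonics of degree four, in the order `m = -4, …, 4`. -/
def harmonicPoly : Fin 9 → MvPolynomial (Fin 3) ℝ :=
  ![X 0 * X 1 * (X 0 ^ 2 - X 1 ^ 2),
    X 1 * X 2 * (3 * X 0 ^ 2 - X 1 ^ 2),
    X 0 * X 1 * (6 * X 2 ^ 2 - X 0 ^ 2 - X 1 ^ 2),
    X 1 * X 2 * (4 * X 2 ^ 2 - 3 * X 0 ^ 2 - 3 * X 1 ^ 2),
    8 * X 2 ^ 4 - 24 * X 2 ^ 2 * (X 0 ^ 2 + X 1 ^ 2) + 3 * (X 0 ^ 2 + X 1 ^ 2) ^ 2,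
    X 0 * X 2 * (4 * X 2 ^ 2 - 3 * X 0 ^ 2 - 3 * X 1 ^ 2),
    (X 0 ^ 2 - X 1 ^ 2) * (6 * X 2 ^ 2 - X 0 ^ 2 - X 1 ^ 2),
    X 0 * X 2 * (X 0 ^ 2 - 3 * X 1 ^ 2),
    X 0 ^ 4 - 6 * X 0 ^ 2 * X 1 ^ 2 + X 1 ^ 4]

/-- The normalizing constants of the real spherical harmonics of degree four, which make them
orthonormal in `L²(S²)`. -/
def harmonicNorm : Fin 9 → ℝ :=
  ![3 / 4 * √(35 / Real.pi), 3 / 4 * √(35 / (2 * Real.pi)), 3 / 4 * √(5 / Real.pi),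
    3 / 4 * √(5 / (2 * Real.pi)), 3 / 16 * √(1 / Real.pi), 3 / 4 * √(5 / (2 * Real.pi)),
    3 / 8 * √(5 / Real.pi), 3 / 4 * √(35 / (2 * Real.pi)), 3 / 16 * √(35 / Real.pi)]

lemma harmonicNorm_pos (k : Fin 9) : 0 < harmonicNorm k := by
  have := Real.pi_pos
  fin_cases k <;> simp [harmonicNorm] <;> positivity

lemma harmonicPoly_mem (k : Fin 9) : harmonicPoly k ∈ bandFour := by
  refine ⟨(MvPolynomial.mem_homogeneousSubmodule 4 _).2 ?_, LinearMap.mem_ker.2 ?_⟩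
  · have h (i : Fin 3) := MvPolynomial.isHomogeneous_X ℝ i
    have hn (m : ℕ) [m.AtLeastTwo] :
        (OfNat.ofNat m : MvPolynomial (Fin 3) ℝ).IsHomogeneous 0 := by
      rw [← map_ofNat (MvPolynomial.C (R := ℝ) (σ := Fin 3)) m]
      exact MvPolynomial.isHomogeneous_C (Fin 3) (OfNat.ofNat m : ℝ)
    fin_cases k
    · exact ((h 0).mul (h 1)).mul (((h 0).pow 2).sub ((h 1).pow 2))
    · exact ((h 1).mul (h 2)).mul (((hn 3).mul ((h 0).pow 2)).sub ((h 1).pow 2))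
    · exact ((h 0).mul (h 1)).mul
        ((((hn 6).mul ((h 2).pow 2)).sub ((h 0).pow 2)).sub ((h 1).pow 2))
    · exact ((h 1).mul (h 2)).mul
        ((((hn 4).mul ((h 2).pow 2)).sub ((hn 3).mul ((h 0).pow 2))).sub
          ((hn 3).mul ((h 1).pow 2)))
    · exact (((hn 8).mul ((h 2).pow 4)).sub
        (((hn 24).mul ((h 2).pow 2)).mul (((h 0).pow 2).add ((h 1).pow 2)))).add
        ((hn 3).mul ((((h 0).pow 2).add ((h 1).pow 2)).pow 2))
    · exact ((h 0).mul (h 2)).mul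
        ((((hn 4).mul ((h 2).pow 2)).sub ((hn 3).mul ((h 0).pow 2))).sub
          ((hn 3).mul ((h 1).pow 2)))
    · exact (((h 0).pow 2).sub ((h 1).pow 2)).mul
        ((((hn 6).mul ((h 2).pow 2)).sub ((h 0).pow 2)).sub ((h 1).pow 2))
    · exact ((h 0).mul (h 2)).mul (((h 0).pow 2).sub ((hn 3).mul ((h 1).pow 2)))
    · exact (((h 0).pow 4).sub (((hn 6).mul ((h 0).pow 2)).mul ((h 1).pow 2))).add ((h 1).pow 4)
  · have hn (m : ℕ) [m.AtLeastTwo] (i : Fin 3) :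
        MvPolynomial.pderiv i (OfNat.ofNat m : MvPolynomial (Fin 3) ℝ) = 0 := by
      exact Derivation.map_natCast _ m
    fin_cases k <;>
      simp [harmonicPoly, laplacian_apply, Fin.sum_univ_three, Derivation.leibniz,
        Derivation.leibniz_pow, MvPolynomial.pderiv_X, hn] <;> ring

open MvPolynomial in
lemma quartic_eq {p : MvPolynomial (Fin 3) ℝ} (hp : p.IsHomogeneous 4) :
    ∃ a : ℕ → ℕ → ℕ → ℝ, p = ∑ d ∈ Finset.Nat.antidiagonalTuple 3 4,
      C (a (d 0) (d 1) (d 2)) * (X 0 ^ d 0 * X 1 ^ d 1 * X 2 ^ d 2) := by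
  classical
  refine ⟨fun i j k => coeff (Finsupp.equivFunOnFinite.symm ![i, j, k]) p, ?_⟩
  have hinj : Function.Injective (Finsupp.equivFunOnFinite (α := Fin 3) (M := ℕ)).symm :=
    Equiv.injective _
  have hsub : p.support ⊆ (Finset.Nat.antidiagonalTuple 3 4).map ⟨_, hinj⟩ := by
    intro d hd
    have h := hp (mem_support_iff.1 hd)
    refine Finset.mem_map.2 ⟨d, ?_, Finsupp.equivFunOnFinite.symm_apply_apply d⟩
    rw [Finset.Nat.mem_antidiagonalTuple]
    rw [← h]
    simp [Finsupp.weight_apply, Finsupp.sum_fintype]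
  conv_lhs => rw [p.as_sum]
  rw [Finset.sum_subset hsub, Finset.sum_map]
  · refine Finset.sum_congr rfl fun d _ => ?_
    have hd : (![d 0, d 1, d 2] : Fin 3 → ℕ) = d := by ext i; fin_cases i <;> rfl
    simp only [Function.Embedding.coeFn_mk, hd]
    rw [monomial_eq, Finsupp.prod_fintype _ _ (by simp), Fin.prod_univ_three]
    rfl
  · intro d _ hd
    rw [notMem_support_iff.1 hd, monomial_zero]

open MvPolynomial in
lemma laplacian_monomial (v : ℝ) (a b c : ℕ) :
    laplacian (C v * (X 0 ^ a * X 1 ^ b * X 2 ^ c)) =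
      C v * ((a * (a - 1 : ℕ) : MvPolynomial (Fin 3) ℝ) * X 0 ^ (a - 2) * X 1 ^ b * X 2 ^ c +
        (b * (b - 1 : ℕ) : MvPolynomial (Fin 3) ℝ) * X 0 ^ a * X 1 ^ (b - 2) * X 2 ^ c +
        (c * (c - 1 : ℕ) : MvPolynomial (Fin 3) ℝ) * X 0 ^ a * X 1 ^ b * X 2 ^ (c - 2)) := by
  simp [laplacian_apply, Fin.sum_univ_three, Derivation.leibniz, Derivation.leibniz_pow,
    MvPolynomial.pderiv_X, Nat.sub_sub]
  ring

lemma antidiagonalTuple_three_four : Finset.Nat.antidiagonalTuple 3 4 =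
    {![0, 0, 4], ![0, 1, 3], ![0, 2, 2], ![0, 3, 1], ![0, 4, 0], ![1, 0, 3], ![1, 1, 2],
      ![1, 2, 1], ![1, 3, 0], ![2, 0, 2], ![2, 1, 1], ![2, 2, 0], ![3, 0, 1], ![3, 1, 0],
      ![4, 0, 0]} := by
  decide

/-- The real spherical harmonics of degree four, in the order `m = -4, …, 4`. -/
def sphericalHarmonic (k : Fin 9) : bandFour :=
  ⟨harmonicNorm k • harmonicPoly k, bandFour.smul_mem _ (harmonicPoly_mem k)⟩

lemma exists_eq_sum_harmonicPoly {p : MvPolynomial (Fin 3) ℝ} (hp : p ∈ bandFour) :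
    ∃ c : Fin 9 → ℝ, p = ∑ k, c k • harmonicPoly k := by
  obtain ⟨h1, h2⟩ := hp
  obtain ⟨a, rfl⟩ := quartic_eq ((MvPolynomial.mem_homogeneousSubmodule 4 p).1 h1)
  clear h1
  rw [SetLike.mem_coe, LinearMap.mem_ker, map_sum] at h2
  simp only [laplacian_monomial] at h2
  rw [antidiagonalTuple_three_four] at h2 ⊢
  have hev (x y z : ℝ) := congrArg (MvPolynomial.eval ![x, y, z]) h2
  simp [Finset.sum_insert] at hev
  have e1 := hev 1 0 0
  have e2 := hev 0 1 0
  have e3 := hev 0 0 1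
  have e4 := hev 1 1 0
  have e5 := hev 1 0 1
  have e6 := hev 0 1 1
  norm_num at e1 e2 e3 e4 e5 e6
  clear hev h2
  refine ⟨![(a 3 1 0 - a 1 3 0) / 2, a 2 1 1 / 3 + a 0 1 3 / 4, a 1 1 2 / 6, a 0 1 3 / 4,
    a 0 0 4 / 8, a 1 0 3 / 4, (a 2 0 2 - a 0 2 2) / 12, a 3 0 1 + 3 * (a 1 0 3 / 4),
    a 0 0 4 / 8 - a 2 2 0 / 6], ?_⟩
  refine MvPolynomial.funext fun x => ?_
  have f1 : a 2 0 2 = -6 * a 0 0 4 - a 0 2 2 := by linarith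
  have f2 : a 4 0 0 = a 0 0 4 + a 0 2 2 / 6 - a 2 2 0 / 6 := by linarith
  have f3 : a 0 4 0 = -(a 2 2 0 + a 0 2 2) / 6 := by linarith
  have f4 : a 1 1 2 = -3 * (a 3 1 0 + a 1 3 0) := by linarith
  have f5 : a 2 1 1 = -3 * (a 0 3 1 + a 0 1 3) := by linarith
  have f6 : a 1 2 1 = -3 * (a 3 0 1 + a 1 0 3) := by linarith
  simp [Finset.sum_insert, Fin.sum_univ_succ, harmonicPoly, MvPolynomial.smul_eval, f1, f2, f3,
    f4, f5, f6]
  ring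

lemma linearIndependent_harmonicPoly : LinearIndependent ℝ harmonicPoly := by
  rw [Fintype.linearIndependent_iff]
  intro c hc
  have hev (x y z : ℝ) := congrArg (MvPolynomial.eval ![x, y, z]) hc
  simp [Fin.sum_univ_succ, harmonicPoly, MvPolynomial.smul_eval] at hev
  have e1 := hev 1 0 0
  have e2 := hev 0 1 0
  have e3 := hev 0 0 1
  have e4 := hev 1 1 0
  have e5 := hev 1 (-1) 0
  have e6 := hev 1 0 1
  have e7 := hev (-1) 0 1
  have e8 := hev 0 1 1
  have e9 := hev 0 (-1) 1
  have e10 := hev 1 2 0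
  have e11 := hev 2 0 1
  have e12 := hev 0 2 1
  have e13 := hev 1 1 1
  have e14 := hev (-1) 1 1
  have e15 := hev 1 (-1) 1
  norm_num at e1 e2 e3 e4 e5 e6 e7 e8 e9 e10 e11 e12 e13 e14 e15
  intro k
  fin_cases k <;> simp <;> linarith

/-- The spherical harmonics of degree four form a basis of the fourth band. -/
def bandFourBasis : Module.Basis (Fin 9) ℝ bandFour :=
  Module.Basis.mk (v := sphericalHarmonic)
    (by
      refine LinearIndependent.of_comp bandFour.subtype ?_
      exact linearIndependent_harmonicPoly.units_smul
        fun k => Units.mk0 (harmonicNorm k) (harmonicNorm_pos k).ne')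
    (by
      rintro ⟨p, hp⟩ -
      obtain ⟨c, hc⟩ := exists_eq_sum_harmonicPoly hp
      have : (⟨p, hp⟩ : bandFour) =
          ∑ k, (c k * (harmonicNorm k)⁻¹) • sphericalHarmonic k := by
        refine Subtype.ext ?_
        rw [Submodule.coe_sum]
        simp only [Submodule.coe_smul, sphericalHarmonic, smul_smul]
        rw [hc]
        refine Finset.sum_congr rfl fun k _ => ?_
        rw [mul_assoc, inv_mul_cancel₀ (harmonicNorm_pos k).ne', mul_one]
      rw [this]
      exact Submodule.sum_mem _ fun k _ =>
        Submodule.smul_mem _ _ (Submodule.subset_span ⟨k, rfl⟩))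

lemma bandFourBasis_apply (k : Fin 9) : bandFourBasis k = sphericalHarmonic k := by
  simp [bandFourBasis]

/-- The representation `ρ` of `SO(3)` on `ℝ⁹`: the matrix of the rotation action on the fourth band
of spherical harmonics, in the basis of real spherical harmonics. -/
def rho : SO3 →* Matrix (Fin 9) (Fin 9) ℝ where
  toFun r := LinearMap.toMatrix bandFourBasis bandFourBasis (bandFourRep r)
  map_one' := by rw [map_one]; exact LinearMap.toMatrix_one _
  map_mul' r s := by rw [map_mul]; exact LinearMap.toMatrix_mul _ _ _

/-! ### The scaled octahedral variety -/

/-- The Euclidean space `ℝ⁹` of coefficient vectors. -/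
abbrev E9 : Type := EuclideanSpace ℝ (Fin 9)

/-- The canonical octahedral frame `q₀`. -/
def canonicalFrame : E9 := !₂[0, 0, 0, 0, √(7 / 12), 0, 0, 0, √(5 / 12)]

/-- The octahedral variety: the orbit of `q₀` under `SO(3)`. -/
def octahedralVariety : Set E9 :=
  Set.range fun r : SO3 => (WithLp.toLp 2 (rho r *ᵥ canonicalFrame.ofLp) : E9)

/-- The scaling factor `α = √(3/20)`. -/
def scaleFactor : ℝ := √(3 / 20)

/-- The scaled octahedral variety `F_α = α F`. -/
def scaledVariety : Set E9 := (fun q => scaleFactor • q) '' octahedralVariety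

/-- The scaled canonical octahedral frame `q_α = α q₀`. -/
def scaledFrame : E9 := scaleFactor • canonicalFrame

/-- The map `SO(3) → F_α`, `r ↦ ρ(r) q_α`. -/
def orbitMap (r : SO3) : scaledVariety :=
  ⟨WithLp.toLp 2 (rho r *ᵥ scaledFrame.ofLp), _, ⟨r, rfl⟩, by
    simp [scaledFrame, Matrix.mulVec_smul]⟩

end OctahedralFrames

end

open OctahedralFrames
open scoped Manifold ContDiff Matrix

noncomputable section

namespace OctahedralFrames

/-! The whole argument runs on one zonal kernel. Put `Z(u)_k = orbitWeight k * harmonicFun k u` for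
`u` in ℝ³. By the addition theorem (`sum_harmonicFun_mul`), `⟨Z(u), Z(v)⟩` is a multiple of the
Legendre polynomial P₄ and depends only on `⟨u, v⟩`, `|u|` and `|v|`. The frame `q_α` equals `Z(e₁)
+ Z(e₂) + Z(e₃)` (`scaledFrame_apply`). Rotation invariance of the kernel then gives `ρ(r) q_α = ∑ᵢ
Z(r eᵢ)`, a sum over the columns of `r` (`orbitMap_apply`). Everything else is computed from this
formula.

Metric: differentiating the kernel once in each variable gives the inner product of two derivatives
of `Z` (`sum_harmonicDeriv_mul`). Columns are orthonormal and tangent vectors are skew in the moving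
frame, so the P₄ correction terms cancel and exactly half the Frobenius product remains. This is the
metric of SO(3) and the reason for `α = √(3/20)` (`inner_mfderiv_orbitMap`). In particular the
differential is injective.

Fibres: `⟨ρ(r) q_α, ρ(s) q_α⟩` is an affine function of the sum of the fourth powers of the entries
of `r⁻¹ s` (`inner_orbitMap`). The squares of these entries sum to 3, so the fourth powers sum to 3
only if every entry is 0 or ±1. These integer rotations are exactly O (`mem_octahedralGroup_iff`),
so the fibres of the orbit map are the cosets of O.

Manifold structure: the induced bijection from the compact space SO(3)/O onto `F_α` is a
homeomorphism. The smooth structure of `F_α` is transported along it, which makes the map a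
diffeomorphism by construction. What must be proved is that the inclusion into ℝ⁹ is smooth and
immersive for this structure. This follows from the injective differential and the inverse function
theorem (`isImmersionAtOfComplement_of_injective`). The metric statements then pass through the
local diffeomorphisms from SO(3). -/

/-! ### The zonal kernel of degree four and its derivatives -/

/-- The unnormalized spherical harmonics of degree four as functions of the coordinates. -/
def harmonicFun (k : Fin 9) (a b c : ℝ) : ℝ :=
  ![a * b * (a ^ 2 - b ^ 2), b * c * (3 * a ^ 2 - b ^ 2), a * b * (6 * c ^ 2 - a ^ 2 - b ^ 2),
    b * c * (4 * c ^ 2 - 3 * a ^ 2 - 3 * b ^ 2),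
    8 * c ^ 4 - 24 * c ^ 2 * (a ^ 2 + b ^ 2) + 3 * (a ^ 2 + b ^ 2) ^ 2,
    a * c * (4 * c ^ 2 - 3 * a ^ 2 - 3 * b ^ 2), (a ^ 2 - b ^ 2) * (6 * c ^ 2 - a ^ 2 - b ^ 2),
    a * c * (a ^ 2 - 3 * b ^ 2), a ^ 4 - 6 * a ^ 2 * b ^ 2 + b ^ 4] k

/-- The derivative of `harmonicFun k` at `(a, b, c)` in the direction `(p, q, r)`. -/
def harmonicDeriv (k : Fin 9) (a b c p q r : ℝ) : ℝ :=
  ![p * (3 * a ^ 2 * b - b ^ 3) + q * (a ^ 3 - 3 * a * b ^ 2),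
    p * (6 * a * b * c) + q * (3 * a ^ 2 * c - 3 * b ^ 2 * c) + r * (3 * a ^ 2 * b - b ^ 3),
    p * (6 * b * c ^ 2 - 3 * a ^ 2 * b - b ^ 3) + q * (6 * a * c ^ 2 - a ^ 3 - 3 * a * b ^ 2) +
      r * (12 * a * b * c),
    p * (-6 * a * b * c) + q * (4 * c ^ 3 - 3 * a ^ 2 * c - 9 * b ^ 2 * c) +
      r * (12 * b * c ^ 2 - 3 * a ^ 2 * b - 3 * b ^ 3),
    p * (12 * a * (a ^ 2 + b ^ 2) - 48 * a * c ^ 2) +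
      q * (12 * b * (a ^ 2 + b ^ 2) - 48 * b * c ^ 2) + r * (32 * c ^ 3 - 48 * c * (a ^ 2 + b ^ 2)),
    p * (4 * c ^ 3 - 9 * a ^ 2 * c - 3 * b ^ 2 * c) + q * (-6 * a * b * c) +
      r * (12 * a * c ^ 2 - 3 * a ^ 3 - 3 * a * b ^ 2),
    p * (12 * a * c ^ 2 - 4 * a ^ 3) + q * (4 * b ^ 3 - 12 * b * c ^ 2) +
      r * (12 * c * (a ^ 2 - b ^ 2)),
    p * (3 * a ^ 2 * c - 3 * b ^ 2 * c) + q * (-6 * a * b * c) + r * (a ^ 3 - 3 * a * b ^ 2),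
    p * (4 * a ^ 3 - 12 * a * b ^ 2) + q * (4 * b ^ 3 - 12 * a ^ 2 * b)] k

lemma hasDerivAt_harmonicFun (k : Fin 9) (a b c p q r : ℝ) :
    HasDerivAt (fun t => harmonicFun k (a + t * p) (b + t * q) (c + t * r))
      (harmonicDeriv k a b c p q r) 0 := by
  have h (x y : ℝ) : HasDerivAt (fun t => x + t * y) y 0 := by
    simpa using ((hasDerivAt_id (0 : ℝ)).mul_const y).const_add x
  have ha := h a p
  have hb := h b q
  have hc := h c r
  have ha2 := ha.fun_pow 2
  have hb2 := hb.fun_pow 2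
  have hc2 := hc.fun_pow 2
  fin_cases k
  · refine ((ha.fun_mul hb).fun_mul (ha2.fun_sub hb2)).congr_deriv ?_
    simp [harmonicDeriv]; ring
  · refine ((hb.fun_mul hc).fun_mul ((ha2.const_mul 3).fun_sub hb2)).congr_deriv ?_
    simp [harmonicDeriv]; ring
  · refine ((ha.fun_mul hb).fun_mul (((hc2.const_mul 6).fun_sub ha2).fun_sub hb2)).congr_deriv ?_
    simp [harmonicDeriv]; ring
  · refine ((hb.fun_mul hc).fun_mul (((hc2.const_mul 4).fun_sub (ha2.const_mul 3)).fun_sub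
      (hb2.const_mul 3))).congr_deriv ?_
    simp [harmonicDeriv]; ring
  · refine ((((hc.fun_pow 4).const_mul 8).fun_sub ((hc2.const_mul 24).fun_mul
      (ha2.fun_add hb2))).fun_add (((ha2.fun_add hb2).fun_pow 2).const_mul 3)).congr_deriv ?_
    simp [harmonicDeriv]; ring
  · refine ((ha.fun_mul hc).fun_mul (((hc2.const_mul 4).fun_sub (ha2.const_mul 3)).fun_sub
      (hb2.const_mul 3))).congr_deriv ?_
    simp [harmonicDeriv]; ring
  · refine ((ha2.fun_sub hb2).fun_mul
      (((hc2.const_mul 6).fun_sub ha2).fun_sub hb2)).congr_deriv ?_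
    simp [harmonicDeriv]; ring
  · refine ((ha.fun_mul hc).fun_mul (ha2.fun_sub (hb2.const_mul 3))).congr_deriv ?_
    simp [harmonicDeriv]; ring
  · refine (((ha.fun_pow 4).fun_sub ((ha2.const_mul 6).fun_mul hb2)).fun_add
      (hb.fun_pow 4)).congr_deriv ?_
    simp [harmonicDeriv]; ring

/-- The coordinates of `r ↦ ρ(r) q_α` are these multiples of sums of spherical harmonics. -/
def orbitWeight (k : Fin 9) : ℝ := √(4 * Real.pi / 315) * harmonicNorm k

/-- The factor π cancels, so the weighted sums over `k` become polynomial identities with rational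
coefficients. -/
lemma orbitWeight_sq (k : Fin 9) : orbitWeight k ^ 2 =
    ![1 / 4, 1 / 8, 1 / 28, 1 / 56, 1 / 2240, 1 / 56, 1 / 112, 1 / 8, 1 / 64] k := by
  have hp := Real.pi_pos
  rw [orbitWeight, mul_pow, Real.sq_sqrt (by positivity)]
  fin_cases k <;> simp only [harmonicNorm] <;> simp [mul_pow] <;>
    (try rw [div_pow]) <;>  (repeat rw [Real.sq_sqrt (by positivity)]) <;> field_simp <;> norm_num <;>
    rw [Real.sq_sqrt hp.le] <;> ring

/-- The addition theorem: the orthonormal harmonics sum to `9/(4π) · P₄` on the sphere, and the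
factor `4π/315` turns this into `P₄/35`, with leading coefficient 1/8. The powers of the norms make
the formula homogeneous, hence valid off the sphere. -/
lemma sum_harmonicFun_mul (a b c a' b' c' : ℝ) :
    ∑ k, orbitWeight k ^ 2 * (harmonicFun k a b c * harmonicFun k a' b' c') =
      1 / 8 * ((a * a' + b * b' + c * c') ^ 4 -
        6 / 7 * (a * a' + b * b' + c * c') ^ 2 * (a ^ 2 + b ^ 2 + c ^ 2) *
          (a' ^ 2 + b' ^ 2 + c' ^ 2) +
        3 / 35 * (a ^ 2 + b ^ 2 + c ^ 2) ^ 2 * (a' ^ 2 + b' ^ 2 + c' ^ 2) ^ 2) := by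
  simp only [orbitWeight_sq]
  simp [Fin.sum_univ_succ, harmonicFun]
  ring

/-- The mixed derivative of the kernel, one direction in each argument. Each direction is orthogonal
to its base point, so the norm factors do not vary to first order. -/
lemma sum_harmonicDeriv_mul (a b c p q r a' b' c' p' q' r' : ℝ) (h : a * p + b * q + c * r = 0)
    (h' : a' * p' + b' * q' + c' * r' = 0) :
    ∑ k, orbitWeight k ^ 2 * (harmonicDeriv k a b c p q r * harmonicDeriv k a' b' c' p' q' r') =
      1 / 8 * (12 * (a * a' + b * b' + c * c') ^ 2 * (p * a' + q * b' + r * c') *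
          (a * p' + b * q' + c * r') +
        4 * (a * a' + b * b' + c * c') ^ 3 * (p * p' + q * q' + r * r') -
        12 / 7 * (a ^ 2 + b ^ 2 + c ^ 2) * (a' ^ 2 + b' ^ 2 + c' ^ 2) *
          ((p * a' + q * b' + r * c') * (a * p' + b * q' + c * r') +
           (a * a' + b * b' + c * c') * (p * p' + q * q' + r * r'))) := by
  simp only [orbitWeight_sq]
  simp [Fin.sum_univ_succ, harmonicDeriv]
  -- The multiples of `h` and `h'` are the terms in which a derivative falls on `|u|²` or `|u'|²`.
  linear_combination
    1 / 8 * (-24 / 7 * (a * a' + b * b' + c * c') * (a * p' + b * q' + c * r') *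
        (a' ^ 2 + b' ^ 2 + c' ^ 2) -
      24 / 7 * (a * a' + b * b' + c * c') ^ 2 * (a' * p' + b' * q' + c' * r') +
      48 / 35 * (a ^ 2 + b ^ 2 + c ^ 2) * (a' ^ 2 + b' ^ 2 + c' ^ 2) *
        (a' * p' + b' * q' + c' * r')) * h -
    3 / 7 * (a * a' + b * b' + c * c') * (p * a' + q * b' + r * c') *
      (a ^ 2 + b ^ 2 + c ^ 2) * h'

lemma eval_harmonicPoly (k : Fin 9) (x : Fin 3 → ℝ) :
    MvPolynomial.eval x (harmonicPoly k) = harmonicFun k (x 0) (x 1) (x 2) := by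
  fin_cases k <;> simp [harmonicPoly, harmonicFun]

lemma orbitWeight_pos (k : Fin 9) : 0 < orbitWeight k :=
  mul_pos (Real.sqrt_pos.2 (by have := Real.pi_pos; positivity)) (harmonicNorm_pos k)

/-- The frame is the degree-four harmonic part of `x⁴ + y⁴ + z⁴` up to scale, that is, the sum of
the zonal harmonics about the three axes. -/
lemma scaledFrame_apply (k : Fin 9) : scaledFrame k = orbitWeight k *
    (harmonicFun k 1 0 0 + harmonicFun k 0 1 0 + harmonicFun k 0 0 1) := by
  -- 14 = 3 + 3 + 8 is the sum of the values of the harmonic with index 4 at the three unit vectors;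
  -- for index 8 the sum is 2 = 1 + 1 + 0.
  have h4 : √(3 / 20) * √(7 / 12) = orbitWeight 4 * 14 := by
    have := orbitWeight_pos 4
    refine (sq_eq_sq₀ (by positivity) (by positivity)).1 ?_
    rw [mul_pow, mul_pow, orbitWeight_sq, Real.sq_sqrt (by norm_num), Real.sq_sqrt (by norm_num)]
    simp; norm_num
  have h8 : √(3 / 20) * √(5 / 12) = orbitWeight 8 * 2 := by
    have := orbitWeight_pos 8
    refine (sq_eq_sq₀ (by positivity) (by positivity)).1 ?_
    rw [mul_pow, mul_pow, orbitWeight_sq, Real.sq_sqrt (by norm_num), Real.sq_sqrt (by norm_num)]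
    simp; norm_num
  by_cases hk4 : k = 4
  · subst hk4
    refine h4.trans ?_
    simp [harmonicFun]; norm_num
  by_cases hk8 : k = 8
  · subst hk8
    refine h8.trans ?_
    simp [harmonicFun]; norm_num
  fin_cases k <;>
    first
    | exact absurd rfl hk4
    | exact absurd rfl hk8
    | simp [scaledFrame, canonicalFrame, harmonicFun]

lemma eval_rotatePoly (r : SO3) (p : MvPolynomial (Fin 3) ℝ) (x : Fin 3 → ℝ) :
    MvPolynomial.eval x (rotatePoly r p) = MvPolynomial.eval (r.1ᵀ *ᵥ x) p := by
  induction p using MvPolynomial.induction_on with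
  | C a => simp [rotatePoly]
  | add p q hp hq => simp only [map_add, hp, hq]
  | mul_X p n hp =>
    rw [map_mul, map_mul, hp, rotatePoly_X, map_mul]
    simp [Matrix.mulVec, dotProduct]

lemma transpose_mul_SO3 (r : SO3) : r.1ᵀ * r.1 = 1 :=
  (Matrix.mem_orthogonalGroup_iff' (Fin 3) ℝ).1 (Matrix.mem_specialOrthogonalGroup_iff.1 r.2).1

lemma mul_transpose_SO3 (r : SO3) : r.1 * r.1ᵀ = 1 :=
  (Matrix.mem_orthogonalGroup_iff (Fin 3) ℝ).1 (Matrix.mem_specialOrthogonalGroup_iff.1 r.2).1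

lemma col_mul_col_SO3 (r : SO3) (i j : Fin 3) :
    r.1 0 i * r.1 0 j + r.1 1 i * r.1 1 j + r.1 2 i * r.1 2 j = if i = j then 1 else 0 := by
  have := congrFun (congrFun (transpose_mul_SO3 r) i) j
  simpa [Matrix.mul_apply, Fin.sum_univ_three, Matrix.one_apply] using this

lemma row_mul_row_SO3 (r : SO3) (i j : Fin 3) :
    r.1 i 0 * r.1 j 0 + r.1 i 1 * r.1 j 1 + r.1 i 2 * r.1 j 2 = if i = j then 1 else 0 := by
  have := congrFun (congrFun (mul_transpose_SO3 r) i) j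
  simpa [Matrix.mul_apply, Fin.sum_univ_three, Matrix.one_apply] using this

/-- The kernel sees only inner products and lengths: `⟨eᵢ, rᵀx⟩ = ⟨r eᵢ, x⟩`, the columns `r eᵢ` are
unit vectors, and `|rᵀx| = |x|`. -/
lemma sum_harmonicFun_rotate (r : SO3) (x : Fin 3 → ℝ) :
    ∑ k, orbitWeight k ^ 2 * ((harmonicFun k 1 0 0 + harmonicFun k 0 1 0 + harmonicFun k 0 0 1) *
      harmonicFun k ((r.1ᵀ *ᵥ x) 0) ((r.1ᵀ *ᵥ x) 1) ((r.1ᵀ *ᵥ x) 2)) =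
    ∑ k, orbitWeight k ^ 2 *
      ((∑ i, harmonicFun k (r.1 0 i) (r.1 1 i) (r.1 2 i)) * harmonicFun k (x 0) (x 1) (x 2)) := by
  have hy (i : Fin 3) : (r.1ᵀ *ᵥ x) i = r.1 0 i * x 0 + r.1 1 i * x 1 + r.1 2 i * x 2 := by
    simp [Matrix.mulVec, dotProduct, Fin.sum_univ_three]
  have hu (i : Fin 3) : r.1 0 i ^ 2 + r.1 1 i ^ 2 + r.1 2 i ^ 2 = 1 := by
    simpa [pow_two] using col_mul_col_SO3 r i i
  have hxy : (r.1ᵀ *ᵥ x) 0 ^ 2 + (r.1ᵀ *ᵥ x) 1 ^ 2 + (r.1ᵀ *ᵥ x) 2 ^ 2 =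
      x 0 ^ 2 + x 1 ^ 2 + x 2 ^ 2 := by
    have hr := row_mul_row_SO3 r
    have h00 := hr 0 0
    have h01 := hr 0 1
    have h02 := hr 0 2
    have h11 := hr 1 1
    have h12 := hr 1 2
    have h22 := hr 2 2
    simp at h00 h01 h02 h11 h12 h22
    simp only [hy]
    linear_combination x 0 ^ 2 * h00 + x 1 ^ 2 * h11 + x 2 ^ 2 * h22 + 2 * x 0 * x 1 * h01 +
      2 * x 0 * x 2 * h02 + 2 * x 1 * x 2 * h12
  simp only [Fin.sum_univ_three (fun i => harmonicFun _ _ _ _), add_mul, mul_add,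
    Finset.sum_add_distrib, sum_harmonicFun_mul, hu, hxy, ← hy]
  ring

lemma eval_sum_bandFourBasis (c : Fin 9 → ℝ) (x : Fin 3 → ℝ) :
    MvPolynomial.eval x (∑ k, c k • bandFourBasis k : bandFour).1 =
      ∑ k, c k * (harmonicNorm k * harmonicFun k (x 0) (x 1) (x 2)) := by
  rw [Submodule.coe_sum, map_sum]
  simp [bandFourBasis_apply, sphericalHarmonic, MvPolynomial.smul_eval, eval_harmonicPoly]

/-! ### The orbit map as a polynomial in the matrix entries -/

/-- The coordinates of `ρ(r) q_α`, as polynomials in the entries of `r`. -/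
lemma orbitMap_apply (r : SO3) (k : Fin 9) : (orbitMap r : E9) k =
    orbitWeight k * ∑ i, harmonicFun k (r.1 0 i) (r.1 1 i) (r.1 2 i) := by
  set d : Fin 9 → ℝ :=
    fun k => orbitWeight k * ∑ i, harmonicFun k (r.1 0 i) (r.1 1 i) (r.1 2 i) with hd
  -- The matrix identity is checked on harmonic polynomials, which are compared by their values at
  -- every point `x`.
  have h1 : bandFourRep r (∑ k, scaledFrame k • bandFourBasis k) = ∑ k, d k • bandFourBasis k := by
    refine Subtype.ext (MvPolynomial.funext fun x => ?_)
    change MvPolynomial.eval x (rotatePoly r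
      (∑ k, scaledFrame k • bandFourBasis k : bandFour).1) = _
    rw [eval_rotatePoly]
    have hC : √(4 * Real.pi / 315) ≠ 0 :=
      (Real.sqrt_pos.2 (by have := Real.pi_pos; positivity)).ne'
    -- The extra factor completes `orbitWeight k * harmonicNorm k` to `orbitWeight k ^ 2`, the
    -- weight of the kernel.
    refine mul_left_cancel₀ hC ?_
    rw [eval_sum_bandFourBasis, eval_sum_bandFourBasis, Finset.mul_sum, Finset.mul_sum]
    refine Eq.trans ?_ ((sum_harmonicFun_rotate r x).trans ?_)
    · refine Finset.sum_congr rfl fun k _ => ?_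
      rw [scaledFrame_apply, orbitWeight]; ring
    · refine Finset.sum_congr rfl fun k _ => ?_
      rw [hd]; simp only [orbitWeight]; ring
  have h2 (c : Fin 9 → ℝ) : ⇑(bandFourBasis.repr (∑ k, c k • bandFourBasis k)) = c :=
    bandFourBasis.repr_sum_self c
  have h3 := LinearMap.toMatrix_mulVec_repr bandFourBasis bandFourBasis (bandFourRep r)
    (∑ k, scaledFrame k • bandFourBasis k)
  rw [h1, h2, h2] at h3
  exact congrFun h3 k

/-- The polynomial map extending `orbitMap` to all matrices. -/
def orbitExt (A : EuclideanSpace ℝ (Fin 3 × Fin 3)) : E9 :=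
  WithLp.toLp 2 fun k => orbitWeight k * ∑ i, harmonicFun k (A (0, i)) (A (1, i)) (A (2, i))

lemma orbitExt_so3Incl (r : SO3) : orbitExt (so3Incl r) = orbitMap r := by
  ext k
  exact (orbitMap_apply r k).symm

lemma contDiff_orbitExt : ContDiff ℝ ∞ orbitExt := by
  refine contDiff_euclidean.2 fun k => ?_
  refine contDiff_const.mul (ContDiff.sum fun i _ => ?_)
  fin_cases k <;> simp [harmonicFun] <;> fun_prop

lemma contMDiff_orbitMap : ContMDiff (𝓡 3) 𝓘(ℝ, E9) ∞ fun r => (orbitMap r : E9) := by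
  simp only [← orbitExt_so3Incl]
  exact contDiff_orbitExt.contMDiff.comp contMDiff_so3Incl

/-- Restricting to the line `t ↦ A + t • V` reduces the derivative to the one-variable computation
`hasDerivAt_harmonicFun`. -/
lemma fderiv_orbitExt_apply (A V : EuclideanSpace ℝ (Fin 3 × Fin 3)) (k : Fin 9) :
    fderiv ℝ orbitExt A V k = orbitWeight k * ∑ i, harmonicDeriv k (A (0, i)) (A (1, i)) (A (2, i))
      (V (0, i)) (V (1, i)) (V (2, i)) := by
  have h1 : HasDerivAt (fun t : ℝ => A + t • V) V 0 := by
    simpa using ((hasDerivAt_id (0 : ℝ)).smul_const V).const_add A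
  have h2 : HasFDerivAt orbitExt (fderiv ℝ orbitExt A) (A + (0 : ℝ) • V) := by
    rw [zero_smul, add_zero]
    exact (contDiff_orbitExt.differentiable (by simp) A).hasFDerivAt
  have h3 := (EuclideanSpace.proj (𝕜 := ℝ) k : E9 →L[ℝ] ℝ).hasFDerivAt.comp_hasDerivAt 0
    (h2.comp_hasDerivAt 0 h1)
  refine h3.unique ?_
  exact (HasDerivAt.fun_sum fun i _ => hasDerivAt_harmonicFun k _ _ _ _ _ _).const_mul _

/-! ### Tangent vectors of SO(3) and the pulled-back metric -/

lemma mdifferentiableAt_so3Incl (g : SO3) :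
    MDifferentiableAt (𝓡 3) 𝓘(ℝ, EuclideanSpace ℝ (Fin 3 × Fin 3)) so3Incl g :=
  (contMDiff_so3Incl g).mdifferentiableAt (by simp)

/-- A tangent vector of `SO(3)`, regarded as a matrix. -/
def tangentMatrix (g : SO3) (v : TangentSpace (𝓡 3) g) : EuclideanSpace ℝ (Fin 3 × Fin 3) :=
  mfderiv (𝓡 3) 𝓘(ℝ, EuclideanSpace ℝ (Fin 3 × Fin 3)) so3Incl g v

lemma mfderiv_comp_so3Incl {V : Type*} [NormedAddCommGroup V] [NormedSpace ℝ V]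
    {F : EuclideanSpace ℝ (Fin 3 × Fin 3) → V} {g : SO3} (hF : DifferentiableAt ℝ F (so3Incl g))
    (v : TangentSpace (𝓡 3) g) :
    (mfderiv (𝓡 3) 𝓘(ℝ, V) (F ∘ so3Incl) g v : V) =
      fderiv ℝ F (so3Incl g) (tangentMatrix g v) := by
  rw [mfderiv_comp g hF.mdifferentiableAt (mdifferentiableAt_so3Incl g), mfderiv_eq_fderiv]
  rfl

/-- Tangent vectors of `SO(3)` are skew-symmetric after translation to the identity. -/
lemma tangentMatrix_skew (g : SO3) (v : TangentSpace (𝓡 3) g) (i j : Fin 3) :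
    (tangentMatrix g v (0, i) * g.1 0 j + tangentMatrix g v (1, i) * g.1 1 j +
      tangentMatrix g v (2, i) * g.1 2 j) +
    (tangentMatrix g v (0, j) * g.1 0 i + tangentMatrix g v (1, j) * g.1 1 i +
      tangentMatrix g v (2, j) * g.1 2 i) = 0 := by
  -- `F` is the `(i, j)` entry of `BᵀB`. It is constant on SO(3), so its derivative vanishes on
  -- tangent vectors.
  let F : EuclideanSpace ℝ (Fin 3 × Fin 3) → ℝ :=
    fun B => B (0, i) * B (0, j) + B (1, i) * B (1, j) + B (2, i) * B (2, j)
  have hp (p : Fin 3 × Fin 3) (A : EuclideanSpace ℝ (Fin 3 × Fin 3)) :=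
    (EuclideanSpace.proj (𝕜 := ℝ) p : EuclideanSpace ℝ (Fin 3 × Fin 3) →L[ℝ] ℝ).hasFDerivAt (x := A)
  have hF := (((hp (0, i) (so3Incl g)).fun_mul (hp (0, j) _)).fun_add
    ((hp (1, i) _).fun_mul (hp (1, j) _))).fun_add ((hp (2, i) _).fun_mul (hp (2, j) _))
  have hF' : HasFDerivAt F _ (so3Incl g) := hF
  have h1 := mfderiv_comp_so3Incl hF'.differentiableAt v
  have h2 : F ∘ so3Incl = fun _ => if i = j then 1 else 0 := funext fun h => col_mul_col_SO3 h i j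
  rw [h2, mfderiv_const, hF'.fderiv] at h1
  have h3 : (0 : ℝ) = _ := h1
  simp [so3Incl] at h3
  linear_combination -h3

lemma mfderiv_orbitMap_apply (g : SO3) (v : TangentSpace (𝓡 3) g) :
    (mfderiv (𝓡 3) 𝓘(ℝ, E9) (fun r => (orbitMap r : E9)) g v : E9) =
      fderiv ℝ orbitExt (so3Incl g) (tangentMatrix g v) := by
  have h : (fun r => (orbitMap r : E9)) = orbitExt ∘ so3Incl :=
    funext fun r => (orbitExt_so3Incl r).symm
  rw [h]
  exact mfderiv_comp_so3Incl (contDiff_orbitExt.differentiable (by simp) _) v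

/-- Parseval's identity for the columns of a rotation. -/
lemma sum_mul_eq_sum_col (g : SO3) (p q r p' q' r' : ℝ) :
    p * p' + q * q' + r * r' = ∑ j, (p * g.1 0 j + q * g.1 1 j + r * g.1 2 j) *
      (g.1 0 j * p' + g.1 1 j * q' + g.1 2 j * r') := by
  have hr := row_mul_row_SO3 g
  have h00 := hr 0 0
  have h01 := hr 0 1
  have h02 := hr 0 2
  have h11 := hr 1 1
  have h12 := hr 1 2
  have h22 := hr 2 2
  simp at h00 h01 h02 h11 h12 h22
  rw [Fin.sum_univ_three]
  linear_combination -(p * p' * h00 + q * q' * h11 + r * r' * h22 + (p * q' + q * p') * h01 +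
    (p * r' + r * p') * h02 + (q * r' + r * q') * h12)

/-- Summing the differentiated kernel over pairs of columns gives a quadratic expression in the skew
matrices `a`, `b` of the two tangent vectors in the frame of columns. With `S = ∑ aᵢₖ bᵢₖ`, the
quartic part contributes `4S`, while skewness gives `∑ aᵢⱼ bⱼᵢ = -S`, so the part with coefficient
12/7 is `-S + S = 0`. The factor 1/8 leaves `S/2`. -/
lemma inner_mfderiv_orbitMap (g : SO3) (v w : TangentSpace (𝓡 3) g) :
    inner (E := E9) ℝ (mfderiv (𝓡 3) 𝓘(ℝ, E9) (fun r => (orbitMap r : E9)) g v)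
      (mfderiv (𝓡 3) 𝓘(ℝ, E9) (fun r => (orbitMap r : E9)) g w) = so3Metric g v w := by
  rw [so3Metric_apply, mfderiv_orbitMap_apply, mfderiv_orbitMap_apply]
  change _ = 1 / 2 * inner ℝ (tangentMatrix g v) (tangentMatrix g w)
  have hv := tangentMatrix_skew g v
  have hw := tangentMatrix_skew g w
  generalize tangentMatrix g v = V at *
  generalize tangentMatrix g w = W at *
  -- The diagonal case of skewness is the orthogonality required by `sum_harmonicDeriv_mul`.
  have hV (i) : g.1 0 i * V (0, i) + g.1 1 i * V (1, i) + g.1 2 i * V (2, i) = 0 := by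
    linear_combination 1 / 2 * hv i i
  have hW (i) : g.1 0 i * W (0, i) + g.1 1 i * W (1, i) + g.1 2 i * W (2, i) = 0 := by
    linear_combination 1 / 2 * hw i i
  have e1 : inner ℝ (fderiv ℝ orbitExt (so3Incl g) V) (fderiv ℝ orbitExt (so3Incl g) W) =
      ∑ i, ∑ j, ∑ k, orbitWeight k ^ 2 *
        (harmonicDeriv k (g.1 0 i) (g.1 1 i) (g.1 2 i) (V (0, i)) (V (1, i)) (V (2, i)) *
        harmonicDeriv k (g.1 0 j) (g.1 1 j) (g.1 2 j) (W (0, j)) (W (1, j)) (W (2, j))) := by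
    rw [PiLp.inner_apply]
    simp only [fderiv_orbitExt_apply, so3Incl, RCLike.inner_apply, conj_trivial]
    simp only [Fin.sum_univ_three, Finset.sum_add_distrib.symm]
    refine Finset.sum_congr rfl fun k _ => ?_
    ring
  have e2 : inner ℝ V W =
      ∑ i, (V (0, i) * W (0, i) + V (1, i) * W (1, i) + V (2, i) * W (2, i)) := by
    rw [PiLp.inner_apply, Fintype.sum_prod_type, Finset.sum_comm]
    simp [Fin.sum_univ_three, mul_comm]
  rw [e1, e2]
  simp only [fun i j => sum_harmonicDeriv_mul _ _ _ _ _ _ _ _ _ _ _ _ (hV i) (hW j),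
    col_mul_col_SO3, pow_two (g.1 _ _)]
  have hb (i j) : W (0, i) * g.1 0 j + W (1, i) * g.1 1 j + W (2, i) * g.1 2 j =
    g.1 0 j * W (0, i) + g.1 1 j * W (1, i) + g.1 2 j * W (2, i) := by ring
  simp only [hb] at hw
  simp only [fun i j => sum_mul_eq_sum_col g (V (0, i)) (V (1, i)) (V (2, i)) (W (0, j)) (W (1, j))
    (W (2, j))]
  set a : Fin 3 → Fin 3 → ℝ :=
    fun i j => V (0, i) * g.1 0 j + V (1, i) * g.1 1 j + V (2, i) * g.1 2 j with ha
  set b : Fin 3 → Fin 3 → ℝ :=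
    fun i j => g.1 0 j * W (0, i) + g.1 1 j * W (1, i) + g.1 2 j * W (2, i) with hbd
  change ∀ i j, a i j + a j i = 0 at hv
  change ∀ i j, b i j + b j i = 0 at hw
  change ∑ i, ∑ j, 1 / 8 * (12 * (if i = j then (1 : ℝ) else 0) ^ 2 * a i j * b j i +
    4 * (if i = j then (1 : ℝ) else 0) ^ 3 * (∑ k, a i k * b j k) -
    12 / 7 * (if i = i then (1 : ℝ) else 0) * (if j = j then (1 : ℝ) else 0) * (a i j * b j i +
      (if i = j then (1 : ℝ) else 0) * (∑ k, a i k * b j k))) =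
    1 / 2 * ∑ i, ∑ k, a i k * b i k
  clear_value a b
  have ha0 (i) : a i i = 0 := by linarith [hv i i]
  have hb0 (i) : b i i = 0 := by linarith [hw i i]
  have ha1 (i j) : a i j = -a j i := by linarith [hv i j]
  have hb1 (i j) : b i j = -b j i := by linarith [hw i j]
  simp [Fin.sum_univ_three, ha0, hb0, ha1 1 0, ha1 2 0, ha1 2 1, hb1 1 0, hb1 2 0, hb1 2 1]
  ring

/-! ### The octahedral group as the group of integer rotations -/

lemma quarterTurn_mem (i : Fin 3) : quarterTurn i ∈ octahedralGroup :=
  Subgroup.subset_closure ⟨i, rfl⟩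

lemma mul_apply_SO3 (g h : SO3) (i j : Fin 3) :
    (g * h).1 i j = g.1 i 0 * h.1 0 j + g.1 i 1 * h.1 1 j + g.1 i 2 * h.1 2 j := by
  change (g.1 * h.1) i j = _
  rw [Matrix.mul_apply, Fin.sum_univ_three]

lemma inv_apply_SO3 (g : SO3) (i j : Fin 3) : (g⁻¹).1 i j = g.1 j i := rfl

lemma int_cases_of_sq_le_one {x : ℝ} (h : ∃ n : ℤ, x = n) (hx : x ^ 2 ≤ 1) :
    x = 0 ∨ x = 1 ∨ x = -1 := by
  obtain ⟨n, rfl⟩ := h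
  have h1 : n ^ 2 ≤ 1 := by exact_mod_cast hx
  have h2 : -1 ≤ n := by nlinarith
  have h3 : n ≤ 1 := by nlinarith
  interval_cases n <;> simp

lemma entry_sq_le_one (g : SO3) (i j : Fin 3) : g.1 i j ^ 2 ≤ 1 := by
  have h := col_mul_col_SO3 g j j
  rw [if_pos rfl] at h
  have h0 := sq_nonneg (g.1 0 j)
  have h1 := sq_nonneg (g.1 1 j)
  have h2 := sq_nonneg (g.1 2 j)
  have h3 : ∀ i, g.1 i j ^ 2 ≤ 1 :=
    Fin.forall_fin_succ.2 ⟨by linarith, Fin.forall_fin_two.2 ⟨by change g.1 1 j ^ 2 ≤ 1; linarith,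
      by change g.1 2 j ^ 2 ≤ 1; linarith⟩⟩
  exact h3 i

/-- A rotation fixing the first axis vector is a plane rotation in the other two coordinates. Having
integer entries, it must be one of the four powers of the quarter turn about that axis. -/
lemma mem_octahedralGroup_of_fixes {g : SO3} (hg : ∀ i j, ∃ n : ℤ, g.1 i j = n)
    (h00 : g.1 0 0 = 1) : g ∈ octahedralGroup := by
  have hr := row_mul_row_SO3 g 0 0
  have hc := col_mul_col_SO3 g 0 0
  have h1 := col_mul_col_SO3 g 1 1
  simp only [if_true, h00] at hr hc h1
  have h01 : g.1 0 1 = 0 := by nlinarith [sq_nonneg (g.1 0 1), sq_nonneg (g.1 0 2)]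
  have h02 : g.1 0 2 = 0 := by nlinarith [sq_nonneg (g.1 0 1), sq_nonneg (g.1 0 2)]
  have h10 : g.1 1 0 = 0 := by nlinarith [sq_nonneg (g.1 1 0), sq_nonneg (g.1 2 0)]
  have h20 : g.1 2 0 = 0 := by nlinarith [sq_nonneg (g.1 1 0), sq_nonneg (g.1 2 0)]
  have ha := adjugate_SO3 g
  rw [Matrix.adjugate_fin_three] at ha
  -- Comparing the adjugate with the transpose gives `g₂₂ = g₁₁` and `g₁₂ = -g₂₁`, so the first
  -- column of the lower block determines `g`.
  have h22 := congrFun (congrFun ha 1) 1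
  have h12 := congrFun (congrFun ha 2) 1
  simp [h00, h01, h02, h10, h20] at h22 h12
  replace h12 := h12.symm
  rw [h01] at h1
  have key (o : SO3) (ho : o ∈ octahedralGroup) (e : ∀ i j, g.1 i j = o.1 i j) :
      g ∈ octahedralGroup := by
    rwa [show g = o from Subtype.ext (Matrix.ext e)]
  have hq := quarterTurn_mem 0
  rcases int_cases_of_sq_le_one (hg 1 1) (entry_sq_le_one g 1 1) with h11 | h11 | h11
  · rcases int_cases_of_sq_le_one (hg 2 1) (entry_sq_le_one g 2 1) with h21 | h21 | h21
    · norm_num [h11, h21] at h1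
    · refine key _ (inv_mem hq) fun i j => ?_
      rw [inv_apply_SO3]
      fin_cases i <;> fin_cases j <;> simp [quarterTurn, *]
    · refine key _ hq fun i j => ?_
      fin_cases i <;> fin_cases j <;> simp [quarterTurn, *]
  · have h21 : g.1 2 1 = 0 := by rw [h11] at h1; nlinarith
    refine key _ (one_mem _) fun i j => ?_
    change _ = (1 : Matrix (Fin 3) (Fin 3) ℝ) i j
    fin_cases i <;> fin_cases j <;> simp [*]
  · have h21 : g.1 2 1 = 0 := by rw [h11] at h1; nlinarith
    refine key _ (mul_mem hq hq) fun i j => ?_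
    rw [mul_apply_SO3]
    fin_cases i <;> fin_cases j <;> simp [quarterTurn, *]

/-- The rotations with integer entries form the octahedral group. -/
lemma mem_octahedralGroup_iff {g : SO3} :
    g ∈ octahedralGroup ↔ ∀ i j, ∃ n : ℤ, g.1 i j = n := by
  refine ⟨fun h => octahedralGroup_int h, fun hg => ?_⟩
  -- The first column of `g` is plus or minus a unit coordinate vector. Some `o` in O carries it to
  -- the first axis, and this reduces to the previous lemma. The cases below supply `o`.
  have key (o : SO3) (ho : o ∈ octahedralGroup) (e : (o * g).1 0 0 = 1) : g ∈ octahedralGroup := by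
    refine (Subgroup.mul_mem_cancel_left _ ho).1 (mem_octahedralGroup_of_fixes (fun i j => ?_) e)
    choose a ha using hg
    choose b hb using fun i j => octahedralGroup_int ho i j
    refine ⟨b i 0 * a 0 j + b i 1 * a 1 j + b i 2 * a 2 j, ?_⟩
    rw [mul_apply_SO3]
    simp [ha, hb]
  have h1 := quarterTurn_mem 1
  have h2 := quarterTurn_mem 2
  have hc := col_mul_col_SO3 g 0 0
  simp only [if_true] at hc
  rcases int_cases_of_sq_le_one (hg 0 0) (entry_sq_le_one g 0 0) with h0 | h0 | h0
  · rcases int_cases_of_sq_le_one (hg 1 0) (entry_sq_le_one g 1 0) with h0' | h0' | h0'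
    · rcases int_cases_of_sq_le_one (hg 2 0) (entry_sq_le_one g 2 0) with h0'' | h0'' | h0''
      · norm_num [h0, h0', h0''] at hc
      · refine key _ h1 ?_
        rw [mul_apply_SO3]
        simp [quarterTurn, *]
      · refine key _ (inv_mem h1) ?_
        simp only [mul_apply_SO3, inv_apply_SO3]
        simp [quarterTurn, *]
    · refine key _ h2 ?_
      rw [mul_apply_SO3]
      simp [quarterTurn, *]
    · refine key _ (inv_mem h2) ?_
      simp only [mul_apply_SO3, inv_apply_SO3]
      simp [quarterTurn, *]
  · exact mem_octahedralGroup_of_fixes hg h0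
  · refine key _ (mul_mem h2 h2) ?_
    simp only [mul_apply_SO3]
    simp [quarterTurn, *]

/-! ### Fibres of the orbit map -/

lemma inner_orbitMap (r s : SO3) : inner ℝ (orbitMap r : E9) (orbitMap s : E9) =
    1 / 8 * ∑ i, ∑ j, (r⁻¹ * s).1 i j ^ 4 - 9 / 40 := by
  have e1 : inner ℝ (orbitMap r : E9) (orbitMap s : E9) =
      ∑ i, ∑ j, ∑ k, orbitWeight k ^ 2 * (harmonicFun k (r.1 0 i) (r.1 1 i) (r.1 2 i) *
        harmonicFun k (s.1 0 j) (s.1 1 j) (s.1 2 j)) := by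
    rw [PiLp.inner_apply]
    simp only [orbitMap_apply, RCLike.inner_apply, conj_trivial]
    simp only [Fin.sum_univ_three, Finset.sum_add_distrib.symm]
    refine Finset.sum_congr rfl fun k _ => ?_
    ring
  have hu (r : SO3) (i : Fin 3) : r.1 0 i ^ 2 + r.1 1 i ^ 2 + r.1 2 i ^ 2 = 1 := by
    simpa [pow_two] using col_mul_col_SO3 r i i
  have ht (i j : Fin 3) : r.1 0 i * s.1 0 j + r.1 1 i * s.1 1 j + r.1 2 i * s.1 2 j =
      (r⁻¹ * s).1 i j := (mul_apply_SO3 r⁻¹ s i j).symm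
  rw [e1]
  simp only [sum_harmonicFun_mul, hu, ht]
  simp only [Fin.sum_univ_three]
  -- The quadratic terms of the kernel add up to a constant because each column of `r⁻¹ s` has norm
  -- one.
  linear_combination -3 / 28 * hu (r⁻¹ * s) 0 - 3 / 28 * hu (r⁻¹ * s) 1 - 3 / 28 * hu (r⁻¹ * s) 2

lemma sum_entry_sq (g : SO3) : ∑ i, ∑ j, g.1 i j ^ 2 = 3 := by
  have h (i : Fin 3) := col_mul_col_SO3 g i i
  simp only [if_true] at h
  simp only [Fin.sum_univ_three]
  linear_combination h 0 + h 1 + h 2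

/-- Entries lie in `[-1, 1]` and their squares sum to 3, so equality forces `x² = x⁴` entrywise,
that is `x ∈ {0, 1, -1}`. -/
lemma sum_entry_pow_four_eq_iff (g : SO3) :
    ∑ i, ∑ j, g.1 i j ^ 4 = 3 ↔ g ∈ octahedralGroup := by
  have hn (i j : Fin 3) : 0 ≤ g.1 i j ^ 2 - g.1 i j ^ 4 := by
    nlinarith [entry_sq_le_one g i j, sq_nonneg (g.1 i j)]
  have h1 : ∑ i, ∑ j, g.1 i j ^ 4 = 3 ↔ ∑ i, ∑ j, (g.1 i j ^ 2 - g.1 i j ^ 4) = 0 := by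
    simp only [Finset.sum_sub_distrib, sum_entry_sq, sub_eq_zero, eq_comm (a := (3 : ℝ))]
  rw [h1, mem_octahedralGroup_iff,
    Finset.sum_eq_zero_iff_of_nonneg fun i _ => Finset.sum_nonneg fun j _ => hn i j]
  simp only [Finset.sum_eq_zero_iff_of_nonneg fun j _ => hn _ j, Finset.mem_univ, true_imp_iff]
  refine forall_congr' fun i => forall_congr' fun j => ⟨fun h => ?_, fun h => ?_⟩
  · have : g.1 i j ^ 2 * ((1 - g.1 i j) * (1 + g.1 i j)) = 0 := by linear_combination h
    rcases mul_eq_zero.1 this with h | h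
    · exact ⟨0, by simpa using h⟩
    · rcases mul_eq_zero.1 h with h | h
      · exact ⟨1, by push_cast; linarith⟩
      · exact ⟨-1, by push_cast; linarith⟩
  · rcases int_cases_of_sq_le_one h (entry_sq_le_one g i j) with h | h | h <;> rw [h] <;> norm_num

/-- The fibres of the orbit map are the cosets of the octahedral group. -/
lemma orbitMap_eq_iff {r s : SO3} : orbitMap r = orbitMap s ↔ frameMk r = frameMk s := by
  have h1 : frameMk r = frameMk s ↔ r⁻¹ * s ∈ octahedralGroup := QuotientGroup.eq
  have hself (r : SO3) : inner ℝ (orbitMap r : E9) (orbitMap r : E9) = 3 / 20 := by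
    rw [inner_orbitMap, (sum_entry_pow_four_eq_iff _).2 (by rw [inv_mul_cancel]; exact one_mem _)]
    norm_num
  rw [h1, ← sum_entry_pow_four_eq_iff]
  constructor
  · intro h
    have h2 := inner_orbitMap r s
    rw [← h, hself] at h2
    linarith
  · intro h
    -- Both vectors have squared norm 3/20, and so does their inner product, so their difference has
    -- norm zero.
    refine Subtype.ext (sub_eq_zero.1 (inner_self_eq_zero (𝕜 := ℝ).1 ?_))
    rw [inner_sub_sub_self, hself, hself, real_inner_comm (orbitMap r : E9), inner_orbitMap r s, h]
    norm_num

/-! ### The homeomorphism from SO(3)/O onto the variety -/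

/-- SO(3) is closed in the box of matrices with entries in `[-1, 1]`. Compactness passes to SO(3)/O
and makes the continuous bijection onto `F_α` a homeomorphism. -/
instance : CompactSpace SO3 := by
  refine isCompact_iff_compactSpace.1 ?_
  have hbox : IsCompact (Set.univ.pi fun _ => Set.univ.pi fun _ => Set.Icc (-1) 1 :
      Set (Matrix (Fin 3) (Fin 3) ℝ)) :=
    isCompact_univ_pi fun _ => isCompact_univ_pi fun _ => isCompact_Icc
  refine hbox.of_isClosed_subset ?_ fun A hA i _ j _ =>
    abs_le.1 ((sq_le_one_iff_abs_le_one _).1 (entry_sq_le_one ⟨A, hA⟩ i j))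
  have h : (Matrix.specialOrthogonalGroup (Fin 3) ℝ : Set (Matrix (Fin 3) (Fin 3) ℝ)) =
      {A | A * Aᵀ = 1} ∩ {A | A.det = 1} := by
    ext A
    exact Matrix.mem_specialOrthogonalGroup_iff.trans
      (and_congr_left' (Matrix.mem_orthogonalGroup_iff (Fin 3) ℝ))
  rw [h]
  exact (isClosed_eq (continuous_id.matrix_mul continuous_id.matrix_transpose)
    continuous_const).inter (isClosed_eq continuous_id.matrix_det continuous_const)

/-- The bijection from `SO(3)/O` onto the scaled octahedral variety. -/
def frameMap : FrameSpace → scaledVariety :=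
  Quotient.lift orbitMap fun _ _ h => orbitMap_eq_iff.2 (Quotient.sound h)

lemma frameMap_frameMk (r : SO3) : frameMap (frameMk r) = orbitMap r := rfl

lemma bijective_frameMap : Function.Bijective frameMap := by
  constructor
  · intro x y h
    obtain ⟨r, rfl⟩ := surjective_frameMk x
    obtain ⟨s, rfl⟩ := surjective_frameMk y
    exact orbitMap_eq_iff.1 h
  · rintro ⟨_, _, ⟨r, rfl⟩, rfl⟩
    refine ⟨frameMk r, Subtype.ext ?_⟩
    simp [frameMap_frameMk, orbitMap, scaledFrame, Matrix.mulVec_smul]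

lemma continuous_frameMap : Continuous frameMap :=
  Continuous.quotient_lift (Continuous.subtype_mk contMDiff_orbitMap.continuous _) _

/-- The homeomorphism from `SO(3)/O` onto the scaled octahedral variety. -/
def frameHomeomorph : FrameSpace ≃ₜ scaledVariety :=
  Continuous.homeoOfEquivCompactToT2 (f := Equiv.ofBijective frameMap bijective_frameMap)
    continuous_frameMap

/-! ### Transport of a smooth structure along a homeomorphism -/

section transport
variable {E : Type*} [NormedAddCommGroup E] [NormedSpace ℝ E] {H : Type*} [TopologicalSpace H]
  (I : ModelWithCorners ℝ E H) {M : Type*} [TopologicalSpace M] [ChartedSpace H M]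
  {X : Type*} [TopologicalSpace X]

/-- The charted space structure transported along a homeomorphism. -/
abbrev transportChartedSpace (h : M ≃ₜ X) : ChartedSpace H X where
  atlas := (fun c => h.symm.toOpenPartialHomeomorph.trans c) '' atlas H M
  chartAt x := h.symm.toOpenPartialHomeomorph.trans (chartAt H (h.symm x))
  mem_chart_source x := by simp
  chart_mem_atlas x := ⟨_, chart_mem_atlas H _, rfl⟩

lemma isManifold_transport {n : ℕ∞ω} [IsManifold I n M] (h : M ≃ₜ X) :
    letI := transportChartedSpace (H := H) h
    IsManifold I n X := by
  let _ := transportChartedSpace (H := H) h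
  have : HasGroupoid X (contDiffGroupoid n I) := by
    constructor
    rintro _ _ ⟨c, hc, rfl⟩ ⟨c', hc', rfl⟩
    -- The homeomorphism cancels in a change of charts, which is therefore the original change of
    -- charts on `M`.
    refine StructureGroupoid.mem_of_eqOnSource _
      (StructureGroupoid.compatible (contDiffGroupoid n I) hc hc') ?_
    constructor
    · ext x; simp
    · intro x _; simp
  exact IsManifold.mk' I n X

/-- A homeomorphism is a diffeomorphism for the transported structure. -/
def transportDiffeomorph (n : ℕ∞ω) [IsManifold I n M] (h : M ≃ₜ X) :
    letI := transportChartedSpace (H := H) h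
    Diffeomorph I I M X n :=
  letI := transportChartedSpace (H := H) h
  haveI := isManifold_transport (n := n) I h
  { h.toEquiv with
    contMDiff_toFun := by
      intro x
      rw [contMDiffAt_iff_target]
      refine ⟨h.continuous.continuousAt, ?_⟩
      -- Read in the transported chart, `h` is the original chart of `M`.
      have h1 : ContMDiffAt I 𝓘(ℝ, E) n (extChartAt I x) x := contMDiffAt_extChartAt
      refine h1.congr_of_eventuallyEq (Filter.Eventually.of_forall fun y => ?_)
      change I (chartAt H (h.symm (h x)) (h.symm (h y))) = I (chartAt H x y)
      rw [h.symm_apply_apply, h.symm_apply_apply]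
    contMDiff_invFun := by
      intro x
      rw [contMDiffAt_iff_target]
      refine ⟨h.symm.continuous.continuousAt, ?_⟩
      exact contMDiffAt_extChartAt (I := I) (x := x) }

end transport

/-! ### Immersions from injective differentials -/

section immersion
variable {E : Type*} [NormedAddCommGroup E] [NormedSpace ℝ E]
  {V : Type*} [NormedAddCommGroup V] [NormedSpace ℝ V]

/-- The inverse function theorem, with a smooth inverse on the whole target. -/
lemma exists_chart_of_hasFDerivAt [CompleteSpace E] {f : E → V} {U : Set E} (hU : IsOpen U)
    (hf : ContDiffOn ℝ ∞ f U) {x : E} (hx : x ∈ U) (e : E ≃L[ℝ] V)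
    (he : HasFDerivAt f (e : E →L[ℝ] V) x) :
    ∃ c : OpenPartialHomeomorph E V, x ∈ c.source ∧ c.source ⊆ U ∧ ⇑c = f ∧
      ContDiffOn ℝ ∞ c.symm c.target := by
  have hfx : ContDiffAt ℝ ∞ f x := hf.contDiffAt (hU.mem_nhds hx)
  let c := hfx.toOpenPartialHomeomorph f he (by simp)
  -- Invertibility of the derivative is an open condition. Restricting to the set where it holds
  -- makes the inverse smooth on the whole target, not only at the image of `x`.
  let S : Set E := U ∩ fderiv ℝ f ⁻¹' Set.range ((↑) : (E ≃L[ℝ] V) → E →L[ℝ] V)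
  have hS : IsOpen S :=
    (hf.continuousOn_fderiv_of_isOpen hU (by simp)).isOpen_inter_preimage hU
      ContinuousLinearEquiv.isOpen
  have hxc : x ∈ c.source := hfx.mem_toOpenPartialHomeomorph_source he (by simp)
  have hxS : x ∈ S := ⟨hx, e, he.fderiv.symm⟩
  refine ⟨c.restrOpen S hS, ⟨hxc, hxS⟩, fun y hy => hy.2.1, rfl, fun y hy => ?_⟩
  refine ContDiffAt.contDiffWithinAt ?_
  obtain ⟨hyU, e', he'⟩ := ((c.restrOpen S hS).map_target hy).2
  have hs := hf.contDiffAt (hU.mem_nhds hyU)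
  refine (c.restrOpen S hS).contDiffAt_symm (f₀' := e') hy ?_ hs
  rw [he']
  exact (hs.differentiableAt (by simp)).hasFDerivAt

variable [FiniteDimensional ℝ E] [FiniteDimensional ℝ V]
  {F : Type*} [NormedAddCommGroup F] [NormedSpace ℝ F] [FiniteDimensional ℝ F]

/-- An injective linear map extends to an isomorphism with a given complement of the right
dimension. -/
lemma exists_continuousLinearEquiv_extending (L : E →L[ℝ] V) (hL : Function.Injective L)
    (hF : Module.finrank ℝ E + Module.finrank ℝ F = Module.finrank ℝ V) :
    ∃ e : (E × F) ≃L[ℝ] V, ∀ u, e (u, 0) = L u := by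
  obtain ⟨W, hW⟩ := Submodule.exists_isCompl (LinearMap.range L.toLinearMap)
  have hd : Module.finrank ℝ F = Module.finrank ℝ W := by
    have h1 := Submodule.finrank_add_eq_of_isCompl hW
    have h2 := LinearMap.finrank_range_of_inj (f := L.toLinearMap) hL
    omega
  let e := ((LinearEquiv.ofInjective L.toLinearMap hL).prodCongr
    (LinearEquiv.ofFinrankEq F W hd)).trans (Submodule.prodEquivOfIsCompl _ _ hW)
  refine ⟨e.toContinuousLinearEquiv, fun u => ?_⟩
  simp [e]

variable {M : Type*} [TopologicalSpace M] [ChartedSpace E M] [IsManifold 𝓘(ℝ, E) ∞ M]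

/-- A smooth map with injective differential is an immersion. -/
lemma isImmersionAtOfComplement_of_injective {f : M → V} {x : M}
    (hf : ContMDiff 𝓘(ℝ, E) 𝓘(ℝ, V) ∞ f)
    (hinj : Function.Injective (mfderiv 𝓘(ℝ, E) 𝓘(ℝ, V) f x))
    (hF : Module.finrank ℝ E + Module.finrank ℝ F = Module.finrank ℝ V) :
    Manifold.IsImmersionAtOfComplement F 𝓘(ℝ, E) 𝓘(ℝ, V) ∞ f x := by
  set φ := chartAt E x with hφ
  let ft : E → V := f ∘ φ.symm
  have hft : ContDiffOn ℝ ∞ ft φ.target :=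
    contMDiffOn_iff_contDiffOn.1 (hf.comp_contMDiffOn contMDiffOn_chart_symm)
  have hx0 : φ x ∈ φ.target := mem_chart_target E x
  let L : E →L[ℝ] V := mfderiv 𝓘(ℝ, E) 𝓘(ℝ, V) f x
  have hd : HasFDerivAt ft L (φ x) := by
    have h := ((hf x).mdifferentiableAt (by simp)).hasMFDerivAt.2
    simp only [writtenInExtChartAt, mfld_simps] at h
    exact hasFDerivWithinAt_univ.1 h
  obtain ⟨e, he⟩ := exists_continuousLinearEquiv_extending (F := F) L hinj hF
  -- The map in the chart is thickened by a complement of the image of its differential. The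
  -- derivative of `G` at `(φ x, 0)` is then the isomorphism `e`, so `G` is a local diffeomorphism.
  let G : E × F → V := fun p => ft p.1 + e (0, p.2)
  have hG : ContDiffOn ℝ ∞ G (φ.target ×ˢ Set.univ) :=
    (hft.comp contDiffOn_fst fun p hp => hp.1).add
      (e.contDiff.comp (contDiff_const.prodMk contDiff_snd)).contDiffOn
  have hGd : HasFDerivAt G (e : E × F →L[ℝ] V) (φ x, 0) := by
    have h1 : HasFDerivAt (fun p : E × F => ft p.1) _ (φ x, 0) :=
      HasFDerivAt.comp (g := ft) (f := Prod.fst) (φ x, (0 : F)) hd hasFDerivAt_fst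
    have h2 := (e.toContinuousLinearMap.comp
      (ContinuousLinearMap.inr ℝ E F ∘L ContinuousLinearMap.snd ℝ E F)).hasFDerivAt (x := (φ x, 0))
    refine (h1.add h2).congr_fderiv ?_
    ext p
    · simp [he]
    · simp
  obtain ⟨c, hxc, hcU, hc, hcs⟩ := exists_chart_of_hasFDerivAt (φ.open_target.prod isOpen_univ)
    hG ⟨hx0, Set.mem_univ _⟩ e hGd
  have hcf : ContDiffOn ℝ ∞ c c.source := hc ▸ hG.mono hcU
  -- The inverse of `G`, followed by `e` to return to `V`, is a chart of `V` in which `f` becomes `u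
  -- ↦ e (u, 0)`.
  let ψ : OpenPartialHomeomorph V V := c.symm.trans e.toHomeomorph.toOpenPartialHomeomorph
  have hψ : ψ ∈ IsManifold.maximalAtlas 𝓘(ℝ, V) ∞ V := by
    refine StructureGroupoid.mem_maximalAtlas_of_mem_groupoid _ ?_
    rw [contDiffGroupoid, mem_groupoid_of_pregroupoid]
    have hψs : ψ.source = c.target := by simp [ψ]
    have hψt : ψ.target = e.symm ⁻¹' c.source := by simp [ψ]
    constructor
    · change ContDiffOn ℝ ∞ (fun y => e (c.symm y)) (ψ.source ∩ Set.range id)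
      rw [hψs]
      exact (e.contDiff.comp_contDiffOn hcs).mono Set.inter_subset_left
    · change ContDiffOn ℝ ∞ (fun y => c (e.symm y)) (ψ.target ∩ Set.range id)
      rw [hψt]
      exact (hcf.comp e.symm.contDiff.contDiffOn fun y hy => hy).mono Set.inter_subset_left
  -- The domain chart is cut down so that `(u, 0)` stays where `G` is inverted.
  let s : Set M := φ.source ∩ φ ⁻¹' ((fun u => (u, (0 : F))) ⁻¹' c.source)
  have hs : IsOpen s := φ.isOpen_inter_preimage (c.open_source.preimage (by fun_prop))
  have hdom : φ.restr s ∈ IsManifold.maximalAtlas 𝓘(ℝ, E) ∞ M :=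
    restr_mem_maximalAtlas (contDiffGroupoid ∞ 𝓘(ℝ, E)) (IsManifold.chart_mem_maximalAtlas x) hs
  have hcu (u : E) : c (u, 0) = ft u := by
    rw [hc]
    change ft u + e (0, 0) = ft u
    rw [Prod.mk_zero_zero, map_zero, add_zero]
  refine Manifold.IsImmersionAtOfComplement.mk_of_continuousAt hf.continuous.continuousAt e
    (φ.restr s) ψ ?_ ?_ hdom hψ ?_
  · rw [OpenPartialHomeomorph.restr_source' _ _ hs]
    exact ⟨mem_chart_source E x, mem_chart_source E x, hxc⟩
  · have h : c (φ x, 0) = f x := by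
      rw [hcu]
      exact congrArg f (φ.left_inv (mem_chart_source E x))
    change f x ∈ c.target ∩ _
    exact ⟨h ▸ c.map_source hxc, Set.mem_univ _⟩
  · intro u hu
    have hu' : u ∈ φ.target ∩ φ.symm ⁻¹' s := by
      simpa [hs.interior_eq] using hu
    have huc : (u, (0 : F)) ∈ c.source := by
      have := hu'.2.2
      rwa [Set.mem_preimage, φ.right_inv hu'.1] at this
    change e (c.symm (ft u)) = e (u, 0)
    rw [← hcu, c.left_inv huc]

end immersion

/-! ### Injectivity of the differentials and equivariance -/

/-- The Cayley chart at `g` extends smoothly to an open set of matrices. By the chain rule its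
differential, which is invertible, factors through that of the inclusion. -/
lemma injective_tangentMatrix (g : SO3) : Function.Injective (tangentMatrix g) := by
  let A : EuclideanSpace ℝ (Fin 3 × Fin 3) → Matrix (Fin 3) (Fin 3) ℝ :=
    fun v => (g⁻¹).1 * Matrix.of fun i j => v (i, j)
  have hA (i j : Fin 3) : ContDiff ℝ ∞ fun v => A v i j := by
    simp only [A, Matrix.mul_apply, Fin.sum_univ_three, Matrix.of_apply]
    fun_prop
  let s : Set (EuclideanSpace ℝ (Fin 3 × Fin 3)) := {v | 1 + (A v).trace ≠ 0}
  have hs : IsOpen s := by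
    refine isOpen_ne.preimage (continuous_const.add ?_)
    exact (continuous_matrix fun i j => (hA i j).continuous).matrix_trace
  have key : ContDiffOn ℝ ∞ (fun v => cayleyCoord (A v)) s :=
    contDiffOn_cayleyCoord (fun i j => (hA i j).contDiffOn) fun _ h => h
  have hg : so3Incl g ∈ s := mem_chart_source E3 g
  have hd : DifferentiableAt ℝ (fun v => cayleyCoord (A v)) (so3Incl g) :=
    (key.contDiffAt (hs.mem_nhds hg)).differentiableAt (by simp)
  have hchart : (fun v => cayleyCoord (A v)) ∘ so3Incl = extChartAt (𝓡 3) g := rfl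
  intro v w hvw
  have h1 := mfderiv_comp_so3Incl hd v
  rw [hvw, ← mfderiv_comp_so3Incl hd w, hchart] at h1
  exact (isInvertible_mfderiv_extChartAt (mem_extChartAt_source g)).injective h1

/-- A vector in the kernel has zero length for the metric of SO(3), so its matrix vanishes. -/
lemma injective_mfderiv_orbitMap (g : SO3) :
    Function.Injective (mfderiv (𝓡 3) 𝓘(ℝ, E9) (fun r => (orbitMap r : E9)) g) := by
  refine (injective_iff_map_eq_zero _).2 fun v hv => ?_
  have h1 := inner_mfderiv_orbitMap g v v
  have h2 : (0 : ℝ) = 1 / 2 * inner ℝ (tangentMatrix g v) (tangentMatrix g v) := by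
    refine Eq.trans ?_ h1
    rw [hv]
    exact (inner_zero_left (E := E9) (𝕜 := ℝ) _).symm
  have h3 : tangentMatrix g v = 0 := inner_self_eq_zero (𝕜 := ℝ).1 (by linarith)
  exact injective_tangentMatrix g (h3.trans (map_zero (mfderiv (𝓡 3) _ so3Incl g)).symm)

lemma orbitMap_mul (r s : SO3) :
    (orbitMap (r * s) : E9).ofLp = rho r *ᵥ (orbitMap s : E9).ofLp := by
  simp [orbitMap, map_mul, Matrix.mulVec_mulVec]

end OctahedralFrames

end

/-- With `α = √(3/20)`, the scaled octahedral variety `F_α` is an embedded submanifold of `ℝ⁹`;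
for the metric induced from `ℝ⁹`, the map `r ↦ ρ(r) q_α` from `SO(3)` with its bi-invariant metric
is a local isometry onto `F_α`, and the induced equivariant map `SO(3)/O → F_α` is a diffeomorphism
and an isometry. -/
theorem proposition1 :
    ∃ _ : ChartedSpace E3 scaledVariety,
      IsManifold (𝓡 3) ∞ scaledVariety ∧
      Manifold.IsSmoothEmbedding (𝓡 3) 𝓘(ℝ, E9) ∞ (Subtype.val : scaledVariety → E9) ∧
      IsLocalIsometry so3Metric (inducedMetric (Subtype.val : scaledVariety → E9)) orbitMap ∧
      ∃ φ : Diffeomorph (𝓡 3) (𝓡 3) FrameSpace scaledVariety ∞,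
        (∀ r : SO3, φ (frameMk r) = orbitMap r) ∧
        (∀ (r : SO3) (x : FrameSpace), (φ (r • x) : E9).ofLp = rho r *ᵥ (φ x : E9).ofLp) ∧
        PreservesMetric frameMetric (inducedMetric (Subtype.val : scaledVariety → E9)) φ := by
  let inst : ChartedSpace E3 scaledVariety := transportChartedSpace frameHomeomorph
  have hM : IsManifold (𝓡 3) ∞ scaledVariety := isManifold_transport (𝓡 3) frameHomeomorph
  let φ : Diffeomorph (𝓡 3) (𝓡 3) FrameSpace scaledVariety ∞ :=
    transportDiffeomorph (𝓡 3) ∞ frameHomeomorph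
  have hφ (r : SO3) : φ (frameMk r) = orbitMap r := rfl
  have hloc : IsLocalDiffeomorph (𝓡 3) (𝓡 3) ∞ orbitMap := fun r =>
    (isLocalDiffeomorph_frameMk r).comp (𝓡 3) scaledVariety (φ.isLocalDiffeomorph (frameMk r))
  have hval : ContMDiff (𝓡 3) 𝓘(ℝ, E9) ∞ (Subtype.val : scaledVariety → E9) := by
    intro y
    obtain ⟨x, rfl⟩ := φ.surjective y
    obtain ⟨r, rfl⟩ := surjective_frameMk x
    -- Near a point of `F_α` the inclusion is a smooth local inverse of `orbitMap` followed by the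
    -- smooth map from SO(3) to ℝ⁹.
    have hinv := (hloc r).localInverse_contMDiffAt
    refine ((contMDiff_orbitMap _).comp _ hinv).congr_of_eventuallyEq ?_
    filter_upwards [(hloc r).localInverse_eventuallyEq_right] with z hz
    exact congrArg Subtype.val hz.symm
  have hchain (r : SO3) (v : TangentSpace (𝓡 3) r) :
      (mfderiv (𝓡 3) 𝓘(ℝ, E9) (Subtype.val : scaledVariety → E9) (orbitMap r)
        (mfderiv (𝓡 3) (𝓡 3) orbitMap r v) : E9) =
      mfderiv (𝓡 3) 𝓘(ℝ, E9) (fun r => (orbitMap r : E9)) r v :=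
    (DFunLike.congr_fun (mfderiv_comp r ((hval _).mdifferentiableAt (by simp))
      ((hloc r).contMDiffAt.mdifferentiableAt (by simp))) v).symm
  have hpres : PreservesMetric so3Metric (inducedMetric (Subtype.val : scaledVariety → E9))
      orbitMap := fun r v w =>
    (congrArg₂ (inner (E := E9) ℝ) (hchain r v) (hchain r w)).trans (inner_mfderiv_orbitMap r v w)
  -- The complement has dimension 6 = 9 - 3.
  have himm : Manifold.IsImmersionOfComplement (EuclideanSpace ℝ (Fin 6)) (𝓡 3) 𝓘(ℝ, E9) ∞
      (Subtype.val : scaledVariety → E9) := by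
    intro y
    refine isImmersionAtOfComplement_of_injective hval ?_ (by simp)
    obtain ⟨x, rfl⟩ := φ.surjective y
    obtain ⟨r, rfl⟩ := surjective_frameMk x
    -- Tangent vectors of `F_α` lift to SO(3), where the composite into ℝ⁹ has injective
    -- differential.
    have hsurj := ((hloc r).mfderivToContinuousLinearEquiv (by simp)).surjective
    intro v w hvw
    obtain ⟨v', rfl⟩ := hsurj v
    obtain ⟨w', rfl⟩ := hsurj w
    exact congrArg _ (injective_mfderiv_orbitMap r
      ((hchain r v').symm.trans (hvw.trans (hchain r w'))))
  refine ⟨inst, hM, ⟨himm.isImmersion, Topology.IsEmbedding.subtypeVal⟩, ⟨hloc, hpres⟩, φ, hφ,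
    fun r x => ?_, fun x v w => ?_⟩
  · obtain ⟨s, rfl⟩ := surjective_frameMk x
    exact orbitMap_mul r s
  · obtain ⟨r, rfl⟩ := surjective_frameMk x
    have hsurj := ((isLocalDiffeomorph_frameMk r).mfderivToContinuousLinearEquiv
      (by simp)).surjective
    obtain ⟨v, rfl⟩ := hsurj v
    obtain ⟨w, rfl⟩ := hsurj w
    have hcomp (v : TangentSpace (𝓡 3) r) := DFunLike.congr_fun (mfderiv_comp r
      ((φ.contMDiff (frameMk r)).mdifferentiableAt (by simp))
      ((contMDiff_frameMk r).mdifferentiableAt (by simp))) v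
    -- Both metrics pull back to the metric of SO(3), and every tangent vector of SO(3)/O lifts
    -- there.
    refine Eq.trans ?_ ((hpres r v w).trans (isLocalIsometry_frameMk.2 r v w).symm)
    exact congrArg₂ (fun a b : E3 => inducedMetric (Subtype.val : scaledVariety → E9)
      (orbitMap r) a b) (hcomp v).symm (hcomp w).symm
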